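/- Conventions. A rooted map of size $n$ is a connected planar graph with $n$ edges (loops and multiple edges allowed), embedded in the oriented sphere so that all faces are discs, together with a root, which is a dangling half-edge attached to a vertex (the root-vertex) inside a face (the root-face); it is considered up to orientation-preserving homeomorphism. Equivalently, it is a set of $2n+1$ half-edges with a permutation $\sigma$ (next half-edge counterclockwise around the vertex) and an involution $\alpha$ (other half of the edge) fixing only the root, connected and satisfying Euler's relation for the sphere, up to relabelling. A tree is a rooted map with a single face. The tour of a tree follows its border from the root in counterclockwise direction; it orders the vertices by their first appearance and meets every corner (a corner being a pair of consecutive half-edges around a vertex); the first corner of a vertex is the first of its corners met by the tour. A non-crossing partition of size $m$ is an equivalence relation $\sim$ on $\{1,\dots,m\}$ for which there are no $a<b<c<d$ with $a\sim c$, $b\sim d$, $a\not\sim b$. In an oriented map each edge from $u$ to $v$ consists of a tail, incident to $u$, and a head, incident to $v$; the root is also a head. A positive cycle is a directed simple cycle (possibly a loop) such that the root-face lies in the region of the sphere situated at its right. A tree-oriented map is an oriented rooted map without positive cycle in which every vertex can be reached from the root-vertex by a directed path. Vertex explosion $\varphi=(\varphi_0,\varphi_1)$. Given a tree-oriented map $\vec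 M$ of size $n$, replace each vertex $v$ by as many vertices as there are heads incident to $v$: each head $h$ at $v$ gives one vertex, to which remain attached $h$ and those tails $t$ at $v$ for which $h$ is the first head encountered counterclockwise around $v$ starting from $t$, in the cyclic order inherited from $v$. Let $\varphi_0(\vec M)$ be the resulting unoriented rooted object. Number its vertices $1,\dots,n+1$ in the order of appearance, and let $\varphi_1(\vec M)$ be the relation on $\{1,\dots,n+1\}$ for which two vertices are equivalent if they come from the same vertex of $\vec M$. Gluing $\psi$. Given a tree $T$ of size $n$ and a non-crossing partition $\sim$ of size $n+1$, identify $\{1,\dots,n+1\}$ with the vertices of $T$ in order of appearance and orient $T$ from the root to the leaves. For each part $\{v_1<\dots<v_k\}$ glue the first corners of $v_1,\dots,v_k$ into one cell (the cells being disjoint) and contract the cell to one vertex. That is, counterclockwise around the new vertex one finds the half-edges of $v_k, v_{k-1},\dots,v_1$ in turn, those of each $v_i$ being listed counterclockwise from its first corner. Let $\psi(T,\sim)$ be the resulting oriented map. Statement. For every $n\ge 0$: (1) for every tree-oriented map $\vec M$ of size $n$, $\varphi_0(\vec M)$ is a tree of size $n$ and $\varphi_1(\vec M)$ is a non-crossing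 partition of size $n+1$; (2) for every tree $T$ of size $n$ and every non-crossing partition $\sim$ of size $n+1$, $\psi(T,\sim)$ is a tree-oriented map of size $n$; (3) $\vec M\mapsto(\varphi_0(\vec M),\varphi_1(\vec M))$ is a well-defined bijection from the set of tree-oriented maps of size $n$ onto the set of pairs consisting of a tree of size $n$ and a non-crossing partition of size $n+1$, and its inverse is $\psi$. -/

import Mathlib

/-- For a permutation `π` of a finite set and an equivalence relation `r`, the permutation
`x ↦ π^k x`, where `k ≥ 1` is least with `π^k x` equivalent to `x`.  It keeps, inside each class
of `r`, the cyclic orders of the cycles of `π`. -/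
noncomputable def inducedFun {H : Type*} (π : Equiv.Perm H) (r : Setoid H) (x : H) : H :=
  (π ^ sInf {k : ℕ | 0 < k ∧ r x ((π ^ k) x)}) x

theorem inducedFun_spec {H : Type*} [Finite H] (π : Equiv.Perm H) (r : Setoid H) (x : H) :
    ∃ k : ℕ, 0 < k ∧ r x ((π ^ k) x) ∧ inducedFun π r x = (π ^ k) x ∧
      ∀ m : ℕ, 0 < m → r x ((π ^ m) x) → k ≤ m := by
  have hne : {k : ℕ | 0 < k ∧ r x ((π ^ k) x)}.Nonempty :=
    ⟨orderOf π, orderOf_pos π, by simp [pow_orderOf_eq_one]⟩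
  have hm := Nat.sInf_mem hne
  exact ⟨_, hm.1, hm.2, rfl, fun m h1 h2 => Nat.sInf_le ⟨h1, h2⟩⟩

theorem inducedFun_injective {H : Type*} [Finite H] (π : Equiv.Perm H) (r : Setoid H) :
    Function.Injective (inducedFun π r) := by
  have key : ∀ (x y : H) (k l : ℕ), 0 < k → k ≤ l → r x ((π ^ k) x) → r y ((π ^ l) y) →
      (π ^ k) x = (π ^ l) y → (∀ m : ℕ, 0 < m → r y ((π ^ m) y) → l ≤ m) → x = y := by
    intro x y k l hk hkl hx hy he hmin
    have hxy : x = (π ^ (l - k)) y := by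
      apply (π ^ k).injective
      rw [he, ← Equiv.Perm.mul_apply, ← pow_add, Nat.add_sub_cancel' hkl]
    rcases Nat.eq_zero_or_pos (l - k) with h0 | h0
    · simpa [h0] using hxy
    · have hr : r y ((π ^ (l - k)) y) := by
        rw [← hxy]
        exact r.trans' hy (r.symm' (he ▸ hx))
      have := hmin _ h0 hr
      omega
  intro x y h
  obtain ⟨k, hk, hkr, hke, hkm⟩ := inducedFun_spec π r x
  obtain ⟨l, hl, hlr, hle, hlm⟩ := inducedFun_spec π r y
  have he : (π ^ k) x = (π ^ l) y := by rw [← hke, ← hle, h]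
  rcases le_total k l with hkl | hkl
  · exact key x y k l hk hkl hkr hlr he hlm
  · exact (key y x l k hl hkl hlr hkr he.symm hkm).symm

/-- `inducedFun π r` as a permutation. -/
noncomputable def inducedPerm {H : Type*} [Finite H] (π : Equiv.Perm H) (r : Setoid H) :
    Equiv.Perm H :=
  Equiv.ofBijective (inducedFun π r)
    (Finite.injective_iff_bijective.mp (inducedFun_injective π r))

/-- An equivalence relation on a linearly ordered set is non-crossing if no `a < b < c < d` satisfy
`a ∼ c`, `b ∼ d` and `a ≁ b`. -/
def IsNonCrossing {S : Type*} [LinearOrder S] (s : Setoid S) : Prop :=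
  ¬ ∃ a b c d : S, a < b ∧ b < c ∧ c < d ∧ s a c ∧ s b d ∧ ¬ s a b

/-- Non-crossing partitions of size `m`. -/
def NonCrossingPartition (m : ℕ) : Type :=
  {s : Setoid (Fin m) // IsNonCrossing s}

/-- The half-edge description of a rooted graph with `n` edges drawn on an oriented surface.  There
are `2 * n` half-edges belonging to edges, and one more, the root, which is a dangling half-edge.
`σ h` is the half-edge following `h` in counterclockwise direction around the vertex incident to
`h`; `α h` is the other half of the edge of `h`, and the root alone has no other half. -/
structure RotationSystem (n : ℕ) where
  σ : Equiv.Perm (Fin (2 * n + 1))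
  α : Equiv.Perm (Fin (2 * n + 1))
  root : Fin (2 * n + 1)
  α_α : ∀ h, α (α h) = h
  α_eq_self_iff : ∀ h, α h = h ↔ h = root

namespace RotationSystem

variable {n : ℕ}

/-- Vertices are the cycles of `σ`. -/
def Vertex (M : RotationSystem n) : Type :=
  Quotient (Equiv.Perm.SameCycle.setoid M.σ)

/-- The vertex incident to a half-edge. -/
def vertex (M : RotationSystem n) (h : Fin (2 * n + 1)) : M.Vertex :=
  Quotient.mk (Equiv.Perm.SameCycle.setoid M.σ) h

/-- One follows `h` from its vertex to the other end of its edge, along the right side, and gets to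
the next half-edge on the border of the face at the right of `h`. The root is followed to its
dangling end and back. -/
def facePerm (M : RotationSystem n) : Equiv.Perm (Fin (2 * n + 1)) :=
  M.σ * M.α

/-- Faces are the cycles of `facePerm`; the cycle of `h` is the face lying at the right of `h`
when `h` is traversed starting from its vertex. -/
def Face (M : RotationSystem n) : Type :=
  Quotient (Equiv.Perm.SameCycle.setoid M.facePerm)

/-- A rooted planar map: connected, and of genus `0` by Euler's relation `V - E + F = 2`. -/
structure IsMap (M : RotationSystem n) : Prop where
  connected : ∀ x y, ∃ g ∈ Subgroup.closure {M.σ, M.α}, g x = y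
  euler : Nat.card M.Vertex + Nat.card M.Face = n + 2

/-- A planted plane tree: a rooted map with a single face. -/
structure IsTree (T : RotationSystem n) : Prop where
  isMap : T.IsMap
  card_face : Nat.card T.Face = 1

/-- Equality of rooted maps up to orientation preserving homeomorphism: relabelling of the
half-edges. -/
def Iso (M M' : RotationSystem n) : Prop :=
  ∃ e : Equiv.Perm (Fin (2 * n + 1)),
    (∀ h, e (M.σ h) = M'.σ (e h)) ∧ (∀ h, e (M.α h) = M'.α (e h)) ∧ e M.root = M'.root

theorem Iso.refl (M : RotationSystem n) : M.Iso M :=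
  ⟨1, by simp, by simp, by simp⟩

theorem Iso.symm {M M' : RotationSystem n} (h : M.Iso M') : M'.Iso M := by
  obtain ⟨e, h1, h2, h3⟩ := h
  refine ⟨e.symm, fun x => ?_, fun x => ?_, ?_⟩
  · rw [Equiv.symm_apply_eq, h1, Equiv.apply_symm_apply]
  · rw [Equiv.symm_apply_eq, h2, Equiv.apply_symm_apply]
  · rw [Equiv.symm_apply_eq, h3]

theorem Iso.trans {M M' M'' : RotationSystem n} (h : M.Iso M') (h' : M'.Iso M'') :
    M.Iso M'' := by
  obtain ⟨e, h1, h2, h3⟩ := h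
  obtain ⟨f, g1, g2, g3⟩ := h'
  exact ⟨f * e, fun x => by simp [h1, g1], fun x => by simp [h2, g2], by simp [h3, g3]⟩

/-- The tour starting at the root (border in counterclockwise direction: each edge is followed with
the tree on the left).  The `j`-th corner met is the one between the half-edge `T.corner j` and the
next half-edge `T.σ (T.corner j)` in counterclockwise direction. A corner is
represented by the first of these two half-edges. -/
def corner (T : RotationSystem n) (j : ℕ) : Fin (2 * n + 1) :=
  T.α ((T.facePerm ^ j) T.root)

/-- The `j`-th corner of the tour is the first one met at its vertex. -/
def IsFirstVisit (T : RotationSystem n) (j : ℕ) : Prop :=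
  ∀ i < j, T.vertex (T.corner i) ≠ T.vertex (T.corner j)

/-- The first corner of the `i`-th vertex (`i = 0, …, n`) in order of appearance. -/
noncomputable def firstCorner (T : RotationSystem n) (i : Fin (n + 1)) : Fin (2 * n + 1) :=
  T.corner (Nat.nth T.IsFirstVisit i)

/-- The `i`-th vertex (`i = 0, …, n`) in order of appearance. -/
noncomputable def nthVertex (T : RotationSystem n) (i : Fin (n + 1)) : T.Vertex :=
  T.vertex (T.firstCorner i)

/-- In a tree with `n` edges the order of appearance identifies `Fin (n + 1)` with the set of
vertices. -/
theorem IsTree.nthVertex_bijective {T : RotationSystem n} (hT : T.IsTree) :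
    Function.Bijective T.nthVertex := by
  have hfin : Finite T.Vertex := Quotient.finite _
  have hcard : Nat.card T.Vertex = n + 1 := by
    have h1 := hT.isMap.euler
    have h2 := hT.card_face
    omega
  have hsub : Subsingleton T.Face := (Nat.card_eq_one_iff_unique.mp hT.card_face).1
  have hvis : ∀ x, ∃ j : ℕ, T.corner j = x := by
    intro x
    have hs : T.facePerm.SameCycle T.root (T.α x) :=
      Quotient.exact (s := Equiv.Perm.SameCycle.setoid T.facePerm) (Subsingleton.elim (α := T.Face)
        (Quotient.mk (Equiv.Perm.SameCycle.setoid T.facePerm) T.root)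
        (Quotient.mk (Equiv.Perm.SameCycle.setoid T.facePerm) (T.α x)))
    obtain ⟨j, hj⟩ := hs.exists_nat_pow_eq
    exact ⟨j, by rw [corner, hj, T.α_α]⟩
  have hinj : Set.InjOn (fun j => T.vertex (T.corner j)) {j | T.IsFirstVisit j} := by
    intro i hi j hj hij
    rcases lt_trichotomy i j with h | h | h
    · exact absurd hij (hj i h)
    · exact h
    · exact absurd hij.symm (hi j h)
  have hsurj : ∀ v : T.Vertex, ∃ j, T.IsFirstVisit j ∧ T.vertex (T.corner j) = v := by
    classical
    intro v
    obtain ⟨x, rfl⟩ : ∃ x, T.vertex x = v := Quotient.exists_rep v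
    obtain ⟨j, hj⟩ := hvis x
    have hex : ∃ j, T.vertex (T.corner j) = T.vertex x := ⟨j, by rw [hj]⟩
    refine ⟨Nat.find hex, fun i hi => ?_, Nat.find_spec hex⟩
    rw [Nat.find_spec hex]
    exact Nat.find_min hex hi
  have hF : {j | T.IsFirstVisit j}.Finite := Set.Finite.of_finite_image (Set.toFinite _) hinj
  have hc : hF.toFinset.card = n + 1 := by
    rw [← hcard, ← Set.ncard_eq_toFinset_card _ hF, ← hinj.ncard_image,
      ← Set.ncard_univ]
    congr 1
    ext v
    simpa using hsurj v
  have hi : Function.Injective T.nthVertex := by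
    intro i j hij
    have hmem : ∀ i : Fin (n + 1), T.IsFirstVisit (Nat.nth T.IsFirstVisit i) := fun i =>
      Nat.nth_mem (i : ℕ) (fun hf => by
        have : hf.toFinset = hF.toFinset := rfl
        rw [this, hc]; exact i.2)
    have h := hinj (hmem i) (hmem j) hij
    have h' := Nat.nth_injOn hF (x₁ := (i : ℕ)) (x₂ := (j : ℕ))
      (by rw [Set.mem_Iio, hc]; exact i.2)
      (by rw [Set.mem_Iio, hc]; exact j.2) h
    exact Fin.ext h'
  have : Nat.card (Fin (n + 1)) = Nat.card T.Vertex := by rw [hcard, Nat.card_fin]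
  exact (Nat.bijective_iff_injective_and_card _).mpr ⟨hi, this⟩

theorem IsTree.firstCorner_injective {T : RotationSystem n} (hT : T.IsTree) :
    Function.Injective T.firstCorner := fun _ _ h =>
  hT.nthVertex_bijective.1 (congrArg T.vertex h)

/-- The underlying graph (loops and multiplicities forgotten), used for distances. -/
def graph (M : RotationSystem n) : SimpleGraph M.Vertex :=
  SimpleGraph.fromRel fun u v => ∃ h, M.vertex h = u ∧ M.vertex (M.α h) = v

/-- Distance from the root-vertex. -/
noncomputable def depth (M : RotationSystem n) (v : M.Vertex) : ℕ :=
  M.graph.dist (M.vertex M.root) v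

end RotationSystem

/-- A rotation system with a set of half-edges called heads; the other half-edges are tails. -/
structure OrientedSystem (n : ℕ) extends RotationSystem n where
  isHead : Fin (2 * n + 1) → Prop

namespace OrientedSystem

variable {n : ℕ}

/-- Each edge has one head and one tail, and the root is a head. -/
structure IsOriented (M : OrientedSystem n) : Prop where
  root_isHead : M.isHead M.root
  isHead_α : ∀ h, h ≠ M.root → (M.isHead (M.α h) ↔ ¬ M.isHead h)

/-- There is an edge oriented from `u` to `v`. -/
def Arc (M : OrientedSystem n) (u v : M.Vertex) : Prop :=
  ∃ t, ¬ M.isHead t ∧ M.vertex t = u ∧ M.vertex (M.α t) = v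

/-- The edges with tails `c 0, …, c k` form, in this cyclic order, a directed simple cycle (a loop
if `k = 0`); the index `i + 1` is taken modulo `k + 1`. -/
structure IsDirectedCycle (M : OrientedSystem n) {k : ℕ} (c : Fin (k + 1) → Fin (2 * n + 1)) :
    Prop where
  tail : ∀ i, ¬ M.isHead (c i)
  consecutive : ∀ i, M.vertex (M.α (c i)) = M.vertex (c (i + 1))
  simple : Function.Injective fun i => M.vertex (c i)

/-- `x` and `y` stand for the faces at the right of the half-edges `x` and `y`. The faces are the
same, or one goes from one to the other by crossing an edge which is not in the cycle `c`. -/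
def AvoidStep (M : OrientedSystem n) {k : ℕ} (c : Fin (k + 1) → Fin (2 * n + 1))
    (x y : Fin (2 * n + 1)) : Prop :=
  y = M.facePerm x ∨ (y = M.α x ∧ ∀ i, x ≠ c i ∧ x ≠ M.α (c i))

/-- The root lies in the exterior region of the directed cycle `c`, that is, the region at its
right: from a face at the right of an edge of `c` one gets to the root-face without crossing `c`. -/
def RootInExterior (M : OrientedSystem n) {k : ℕ} (c : Fin (k + 1) → Fin (2 * n + 1)) : Prop :=
  ∃ i, Relation.EqvGen (M.AvoidStep c) (c i) M.root

/-- A tree-oriented map: an oriented rooted planar map without positive cycle (a directed simple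
cycle with the root in its exterior region) such that every vertex can be reached from the root by
a directed path. -/
structure IsTreeOriented (M : OrientedSystem n) : Prop where
  isMap : M.IsMap
  isOriented : M.IsOriented
  reachable : ∀ v, Relation.ReflTransGen M.Arc (M.vertex M.root) v
  no_positive_cycle : ∀ (k : ℕ) (c : Fin (k + 1) → Fin (2 * n + 1)),
    M.IsDirectedCycle c → ¬ M.RootInExterior c

/-- Equality of oriented rooted maps up to relabelling of the half-edges. -/
def Iso (M M' : OrientedSystem n) : Prop :=
  ∃ e : Equiv.Perm (Fin (2 * n + 1)),
    (∀ h, e (M.σ h) = M'.σ (e h)) ∧ (∀ h, e (M.α h) = M'.α (e h)) ∧ e M.root = M'.root ∧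
      ∀ h, M'.isHead (e h) ↔ M.isHead h

theorem Iso.refl (M : OrientedSystem n) : M.Iso M :=
  ⟨1, by simp, by simp, by simp, by simp⟩

theorem Iso.symm {M M' : OrientedSystem n} (h : M.Iso M') : M'.Iso M := by
  obtain ⟨e, h1, h2, h3, h4⟩ := h
  refine ⟨e.symm, fun x => ?_, fun x => ?_, ?_, fun x => ?_⟩
  · rw [Equiv.symm_apply_eq, h1, Equiv.apply_symm_apply]
  · rw [Equiv.symm_apply_eq, h2, Equiv.apply_symm_apply]
  · rw [Equiv.symm_apply_eq, h3]
  · rw [← h4, Equiv.apply_symm_apply]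

theorem Iso.trans {M M' M'' : OrientedSystem n} (h : M.Iso M') (h' : M'.Iso M'') :
    M.Iso M'' := by
  obtain ⟨e, h1, h2, h3, h4⟩ := h
  obtain ⟨f, g1, g2, g3, g4⟩ := h'
  exact ⟨f * e, fun x => by simp [h1, g1], fun x => by simp [h2, g2], by simp [h3, g3],
    fun x => by simp [g4, h4]⟩

/-- The first head encountered in counterclockwise direction around the vertex of `x`, starting
from `x` (`x` itself if it is a head). -/
noncomputable def firstHead (M : OrientedSystem n) (x : Fin (2 * n + 1)) : Fin (2 * n + 1) :=
  (M.σ ^ sInf {k : ℕ | M.isHead ((M.σ ^ k) x)}) x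

/-- The map `φ₀`, vertex explosion: two half-edges at a vertex stay adjacent iff they have the same
first head, and they keep their cyclic order.  The edges and the root do not change, and the
orientation is forgotten. -/
noncomputable def explode (M : OrientedSystem n) : RotationSystem n where
  σ := inducedPerm M.σ (Setoid.ker M.firstHead)
  α := M.α
  root := M.root
  α_α := M.α_α
  α_eq_self_iff := M.α_eq_self_iff

/-- The map `φ₁`: the vertices of the exploded map are numbered in order of appearance, and two of
them are equivalent if they come from the same vertex of `M`. -/
noncomputable def explosionPartition (M : OrientedSystem n) : Setoid (Fin (n + 1)) :=
  Setoid.ker fun i => M.vertex (M.explode.firstCorner i)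

end OrientedSystem

namespace RotationSystem

variable {n : ℕ}

/-- The map `ψ`, for a tree `T` and an equivalence relation `s` on its vertices, numbered in order
of appearance.  `T` is oriented from the root to the leaves.  For each part of `s`, a cell is glued
to the first corners of its vertices and is contracted to a single vertex.  Seen from the cell,
which lies in the outer face, the corners come in clockwise direction in the order of appearance;
hence in counterclockwise direction around the contracted vertex the half-edges of the `i`-th
vertex of `T`, which end with `firstCorner i`, are followed by those of the `j`-th one, starting
after `firstCorner j`, where `j` is the element of the part of `i` that cyclically precedes `i`. -/
noncomputable def glue (T : RotationSystem n) (hT : T.IsTree) (s : Setoid (Fin (n + 1))) :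
    OrientedSystem n where
  σ := T.σ * Equiv.Perm.viaEmbedding (inducedPerm (finRotate (n + 1))⁻¹ s)
    ⟨T.firstCorner, hT.firstCorner_injective⟩
  α := T.α
  root := T.root
  α_α := T.α_α
  α_eq_self_iff := T.α_eq_self_iff
  isHead h := h = T.root ∨ T.depth (T.vertex (T.α h)) < T.depth (T.vertex h)

end RotationSystem

/-- Identification of isomorphic trees. -/
def treeSetoid (n : ℕ) : Setoid {T : RotationSystem n // T.IsTree} where
  r T T' := T.1.Iso T'.1
  iseqv := ⟨fun _ => .refl _, fun h => h.symm, fun h h' => h.trans h'⟩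

/-- Planted plane trees of size `n`. -/
def PlaneTree (n : ℕ) : Type := Quotient (treeSetoid n)

/-- The planted plane tree with a given half-edge description. -/
def PlaneTree.mk {n : ℕ} (T : RotationSystem n) (hT : T.IsTree) : PlaneTree n :=
  Quotient.mk (treeSetoid n) ⟨T, hT⟩

/-- Identification of isomorphic tree-oriented maps. -/
def treeOrientedSetoid (n : ℕ) : Setoid {M : OrientedSystem n // M.IsTreeOriented} where
  r M M' := M.1.Iso M'.1
  iseqv := ⟨fun _ => .refl _, fun h => h.symm, fun h h' => h.trans h'⟩

/-- Tree-oriented maps of size `n`. -/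
def TreeOrientedMap (n : ℕ) : Type := Quotient (treeOrientedSetoid n)

/-- The tree-oriented map with a given half-edge description. -/
def TreeOrientedMap.mk {n : ℕ} (M : OrientedSystem n) (hM : M.IsTreeOriented) :
    TreeOrientedMap n :=
  Quotient.mk (treeOrientedSetoid n) ⟨M, hM⟩

/-! Follow, from a head of a tree-oriented map, its edge back to the tail and then the head that
keeps this tail in the explosion. A cycle of this parent map away from the root would be a directed
cycle of the map with no head entering it from the left, so the root could not lie at its left, and
at its right it would make the cycle positive. Hence the exploded object, which has one head at each
vertex, is an arborescence, and so a tree.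

Planarity enters through face functions. A rational function `F` on the vertices of a tree with zero
sum on each block of a non-crossing partition satisfies `∑_{i < a} F i = ∑_{i ≤ b} F i` whenever `b`
cyclically precedes `a` in its block; so its sums along the tour give a face function of the glued
system, and there are enough of those to force Euler's relation. Conversely, in an exploded map the
jumps of these tour sums are a circulation, so by planarity the tour sums are face functions of the
original map, and the resulting identities between partial sums of all such `F` say that the
partition is non-crossing and determine the cyclic order in which its blocks were split. -/

open Finset

section Permutations

variable {X Y : Type*} {π ρ : Equiv.Perm X}

theorem mem_of_sameCycle [Finite X] {s : Set X} (hs : Set.MapsTo π s s) {x y : X}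
    (h : π.SameCycle x y) (hx : x ∈ s) : y ∈ s := by
  obtain ⟨k, rfl⟩ := h.exists_nat_pow_eq
  exact hs.perm_pow k hx

theorem apply_eq_of_sameCycle [Finite X] {f : X → Y} (hf : ∀ x, f (π x) = f x) {x y : X}
    (h : π.SameCycle x y) : f x = f y :=
  (mem_of_sameCycle (s := {z | f z = f x}) (fun z hz => (hf z).trans hz) h rfl).symm

theorem sameCycle_of_eq_off_transversal [Finite X] {p : X → Prop}
    (hπρ : ∀ x, ¬ p x → π x = ρ x) (hp : ∀ a b, p a → p b → ρ.SameCycle a b → a = b)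
    {x y : X} (hy : p y) (h : ρ.SameCycle x y) : π.SameCycle x y := by
  obtain ⟨k, hk⟩ := h.exists_nat_pow_eq
  induction k generalizing x with
  | zero => exact hk ▸ .refl _ _
  | succ k ih =>
    by_cases hx : p x
    · rw [hp x y hx hy h]
    · have hρx : π.SameCycle (ρ x) y :=
        ih (Equiv.Perm.sameCycle_apply_left.2 h) (by rwa [← Equiv.Perm.mul_apply, ← pow_succ])
      rwa [← hπρ x hx, Equiv.Perm.sameCycle_apply_left] at hρx

theorem perm_eq_of_eq_off_transversal {p : X → Prop} {f : X → Y}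
    (hπρ : ∀ x, ¬ p x → π x = ρ x) (hπ : ∀ x, f (π x) = f x) (hρ : ∀ x, f (ρ x) = f x)
    (hf : ∀ a b, p a → p b → f a = f b → a = b) : π = ρ := by
  ext x
  by_cases hx : p x
  · obtain ⟨y, hy⟩ := π.surjective (ρ x)
    by_cases hyp : p y
    · rw [← hy, hf y x hyp hx (by rw [← hπ, hy, hρ])]
    · rw [hπρ y hyp] at hy
      exact absurd (ρ.injective hy ▸ hx) hyp
  · exact hπρ x hx

theorem sameCycle_map_iff {e : Equiv.Perm X} (h : SemiconjBy e π ρ) {x y : X} :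
    ρ.SameCycle (e x) (e y) ↔ π.SameCycle x y := by
  rw [eq_mul_inv_of_mul_eq h.eq.symm, Equiv.Perm.sameCycle_conj]
  simp

end Permutations

section InducedPerm

variable {H : Type*} {π : Equiv.Perm H} {r : Setoid H}

theorem inducedFun_map {ρ e : Equiv.Perm H} {s : Setoid H} (h : SemiconjBy e π ρ)
    (hrs : ∀ x y, s (e x) (e y) ↔ r x y) (x : H) :
    e (inducedFun π r x) = inducedFun ρ s (e x) := by
  have hpow (k : ℕ) (y : H) : e ((π ^ k) y) = (ρ ^ k) (e y) :=
    Equiv.congr_fun (h.pow_right k).eq y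
  simp only [inducedFun, hpow, ← hrs]

variable [Finite H]

theorem inducedPerm_apply (π : Equiv.Perm H) (r : Setoid H) (x : H) :
    inducedPerm π r x = inducedFun π r x := rfl

theorem rel_inducedPerm (π : Equiv.Perm H) (r : Setoid H) (x : H) :
    r x (inducedPerm π r x) := by
  obtain ⟨k, -, hr, hk, -⟩ := inducedFun_spec π r x
  rwa [inducedPerm_apply, hk]

theorem inducedPerm_eq_of_rel {x : H} (h : r x (π x)) : inducedPerm π r x = π x := by
  obtain ⟨k, hpos, -, hk, hmin⟩ := inducedFun_spec π r x
  have : k = 1 := le_antisymm (hmin 1 one_pos (by simpa using h)) hpos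
  rw [inducedPerm_apply, hk, this, pow_one]

theorem sameCycle_inducedPerm_pow (m : ℕ) :
    ∀ x, r x ((π ^ m) x) → (inducedPerm π r).SameCycle x ((π ^ m) x) := by
  induction m using Nat.strong_induction_on with
  | _ m ih =>
    intro x hx
    rcases Nat.eq_zero_or_pos m with rfl | hm
    · exact .refl _ _
    obtain ⟨k, hpos, -, hk, hmin⟩ := inducedFun_spec π r x
    have hsplit : (π ^ m) x = (π ^ (m - k)) (inducedPerm π r x) := by
      rw [inducedPerm_apply, hk, ← Equiv.Perm.mul_apply, ← pow_add,
        Nat.sub_add_cancel (hmin m hm hx)]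
    rw [hsplit, ← Equiv.Perm.sameCycle_apply_left]
    refine ih (m - k) (by omega) _ ?_
    rw [← hsplit]
    exact r.trans' (r.symm' (rel_inducedPerm π r x)) hx

theorem sameCycle_inducedPerm_iff {x y : H} :
    (inducedPerm π r).SameCycle x y ↔ π.SameCycle x y ∧ r x y := by
  refine ⟨fun h => ⟨?_, ?_⟩, fun ⟨h, hr⟩ => ?_⟩
  · refine mem_of_sameCycle (s := {z | π.SameCycle x z}) (fun z hz => ?_) h (.refl _ _)
    obtain ⟨k, -, -, hk, -⟩ := inducedFun_spec π r z
    rwa [Set.mem_ofPred_eq, inducedPerm_apply, hk, Equiv.Perm.sameCycle_pow_right]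
  · exact mem_of_sameCycle (s := {z | r x z})
      (fun z hz => r.trans' hz (rel_inducedPerm π r z)) h (r.refl' x)
  · obtain ⟨m, rfl⟩ := h.exists_nat_pow_eq
    exact sameCycle_inducedPerm_pow m x hr

end InducedPerm

section CyclicPredecessor

/-- `b` is the element of the part of `a` that cyclically precedes `a`: the largest one below `a`
or, if there is none, the largest one. -/
def CyclicPred {S : Type*} [LinearOrder S] (s : Setoid S) (a b : S) : Prop :=
  s a b ∧ ((b < a ∧ ∀ c, b < c → c < a → ¬ s a c) ∨
    (a ≤ b ∧ (∀ c, c < a → ¬ s a c) ∧ ∀ c, b < c → ¬ s a c))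

theorem CyclicPred.unique {S : Type*} [LinearOrder S] {s : Setoid S} {a b b' : S}
    (h : CyclicPred s a b) (h' : CyclicPred s a b') : b = b' := by
  unfold CyclicPred at h h'
  grind

variable {n : ℕ}

section
open scoped Fin.CommRing

theorem finRotate_inv_pow_apply (k : ℕ) (a : Fin (n + 1)) :
    ((finRotate (n + 1))⁻¹ ^ k) a = a - k := by
  rw [inv_pow, Equiv.Perm.inv_eq_iff_eq]
  induction k generalizing a with
  | zero => simp
  | succ k ih =>
    rw [pow_succ, Equiv.Perm.mul_apply, finRotate_apply, Nat.cast_succ, sub_add_eq_sub_sub,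
      sub_add_cancel, ← ih]

theorem finRotate_inv_pow_sub {a c : Fin (n + 1)} (h : c ≤ a) :
    ((finRotate (n + 1))⁻¹ ^ (a - c : ℕ)) a = c := by
  rw [finRotate_inv_pow_apply, Nat.cast_sub h, Fin.cast_val_eq_self, Fin.cast_val_eq_self,
    sub_sub_cancel]

theorem finRotate_inv_pow_add_sub (a c : Fin (n + 1)) :
    ((finRotate (n + 1))⁻¹ ^ (n + 1 + a - c : ℕ)) a = c := by
  rw [finRotate_inv_pow_apply, Nat.cast_sub (by omega), Nat.cast_add, Fin.natCast_self, zero_add,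
    Fin.cast_val_eq_self, Fin.cast_val_eq_self, sub_sub_cancel]

end

theorem cyclicPred_inducedPerm (s : Setoid (Fin (n + 1))) (a : Fin (n + 1)) :
    CyclicPred s a (inducedPerm (finRotate (n + 1))⁻¹ s a) := by
  refine ⟨rel_inducedPerm _ s a, ?_⟩
  obtain ⟨k, hpos, -, hk, hmin⟩ := inducedFun_spec (finRotate (n + 1))⁻¹ s a
  have hle_below {c : Fin (n + 1)} (hc : c < a) (hs : s a c) : k ≤ a - c :=
    hmin _ (by omega) (by rwa [finRotate_inv_pow_sub hc.le])
  have hle {c : Fin (n + 1)} (hs : s a c) : k ≤ n + 1 + a - c :=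
    hmin _ (by omega) (by rwa [finRotate_inv_pow_add_sub])
  have hkn : k ≤ n + 1 := (hle (s.refl' a)).trans (by omega)
  rw [inducedPerm_apply, hk]
  rcases le_or_gt k a with hka | hka
  · obtain ⟨b, rfl, hb⟩ : ∃ b : Fin (n + 1), k = a - b ∧ b < a :=
      ⟨⟨a - k, by omega⟩, (Nat.sub_sub_self hka).symm, Fin.lt_def.2 (by simp only; omega)⟩
    rw [finRotate_inv_pow_sub hb.le]
    exact Or.inl ⟨hb, fun c hbc hca hs => by have := hle_below hca hs; omega⟩
  · obtain ⟨b, rfl, hb⟩ : ∃ b : Fin (n + 1), k = n + 1 + a - b ∧ a ≤ b :=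
      ⟨⟨n + 1 + a - k, by omega⟩, by simp only; omega, Fin.le_def.2 (by simp only; omega)⟩
    rw [finRotate_inv_pow_add_sub]
    exact Or.inr ⟨hb, fun c hca hs => by have := hle_below hca hs; omega,
      fun c hbc hs => by have := hle hs; omega⟩

theorem sameCycle_inducedPerm_finRotate {s : Setoid (Fin (n + 1))} {a b : Fin (n + 1)}
    (h : s a b) : (inducedPerm (finRotate (n + 1))⁻¹ s).SameCycle a b :=
  sameCycle_inducedPerm_iff.2
    ⟨⟨(n + 1 + a - b : ℕ), by rw [zpow_natCast, finRotate_inv_pow_add_sub]⟩, h⟩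

end CyclicPredecessor

section BlockSum

variable {S : Type*} [Fintype S] {s : Setoid S} {F : S → ℚ}

open Classical in
/-- The sums of a function over the parts of a partition; the functions in its kernel are those
whose sum over each part vanishes. -/
noncomputable def blockSum (s : Setoid S) : (S → ℚ) →ₗ[ℚ] Quotient s → ℚ :=
  LinearMap.pi fun q => ∑ b with Quotient.mk s b = q, LinearMap.proj b

open Classical in
theorem blockSum_apply (s : Setoid S) (F : S → ℚ) (q : Quotient s) :
    blockSum s F q = ∑ b with Quotient.mk s b = q, F b := by
  simp [blockSum]

theorem sum_mul_eq_zero_of_blockSum_eq_zero (hF : blockSum s F = 0) {u : S → ℚ}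
    (hu : ∀ a b, s a b → u a = u b) : ∑ b, u b * F b = 0 := by
  classical
  rw [← sum_fiberwise univ (Quotient.mk s)]
  refine sum_eq_zero fun q _ => ?_
  have hq : ∑ b with Quotient.mk s b = q, F b = 0 := by
    simpa only [blockSum_apply, Pi.zero_apply] using congrFun hF q
  calc ∑ b with Quotient.mk s b = q, u b * F b
      = ∑ b with Quotient.mk s b = q, u q.out * F b := by
        refine sum_congr rfl fun b hb => ?_
        rw [hu b q.out (Quotient.exact ((mem_filter.1 hb).2.trans q.out_eq.symm))]
    _ = 0 := by rw [← mul_sum, hq, mul_zero]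

theorem sum_eq_zero_of_blockSum_eq_zero (hF : blockSum s F = 0) {U : Finset S}
    (hU : ∀ a b, s a b → a ∈ U → b ∈ U) : ∑ b ∈ U, F b = 0 := by
  classical
  have := sum_mul_eq_zero_of_blockSum_eq_zero hF (u := fun b => if b ∈ U then 1 else 0)
    fun a b hab => by simp only [show a ∈ U ↔ b ∈ U from ⟨hU a b hab, hU b a (s.symm' hab)⟩]
  simpa using this

theorem blockSum_single_sub_single [DecidableEq S] {i k : S} (h : s i k) :
    blockSum s (Pi.single i 1 - Pi.single k 1) = 0 := by
  classical
  ext q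
  have single (j : S) : blockSum s (Pi.single j 1) q = if Quotient.mk s j = q then 1 else 0 := by
    rw [blockSum_apply, sum_filter, Fintype.sum_eq_single j fun b hb => by simp [hb]]
    simp
  rw [map_sub, Pi.sub_apply, single, single, Quotient.sound h, sub_self, Pi.zero_apply]

theorem card_le_finrank_ker_blockSum_add (s : Setoid S) :
    Fintype.card S ≤ Module.finrank ℚ (LinearMap.ker (blockSum s)) + Nat.card (Quotient s) := by
  classical
  have hrank := LinearMap.finrank_range_add_finrank_ker (blockSum s)
  have hrange := Submodule.finrank_le (LinearMap.range (blockSum s))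
  rw [Module.finrank_fintype_fun_eq_card] at hrank hrange
  rw [Nat.card_eq_fintype_card]
  omega

end BlockSum

section SumIioIic

variable {S : Type*} [Fintype S] [LinearOrder S] [LocallyFiniteOrderBot S] {s : Setoid S}
  {a b i k : S}

theorem mem_Ioc_iff_mem_Ico_of_sum_Iio_eq_sum_Iic
    (h : ∀ F, blockSum s F = 0 → ∑ c ∈ Iio a, F c = ∑ c ∈ Iic b, F c) (hik : s i k)
    (hlt : i < k) : a ∈ Set.Ioc i k ↔ b ∈ Set.Ico i k := by
  have hsum := h _ (blockSum_single_sub_single hik)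
  simp only [Pi.sub_apply, sum_sub_distrib, sum_pi_single', mem_Iio, mem_Iic] at hsum
  rw [Set.mem_Ioc, Set.mem_Ico]
  split_ifs at hsum <;> grind

theorem cyclicPred_of_sum_Iio_eq_sum_Iic (hab : s a b)
    (h : ∀ F, blockSum s F = 0 → ∑ c ∈ Iio a, F c = ∑ c ∈ Iic b, F c) : CyclicPred s a b := by
  have hiff {i k} := mem_Ioc_iff_mem_Ico_of_sum_Iio_eq_sum_Iic h (i := i) (k := k)
  have hbelow {c} (hca : c < a) (hac : s a c) : b ∈ Set.Ico c a :=
    (hiff (s.symm' hac) hca).1 ⟨hca, le_rfl⟩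
  refine ⟨hab, ?_⟩
  rcases lt_or_ge b a with hba | hab'
  · exact Or.inl ⟨hba, fun c hbc hca hac => hbc.not_ge (hbelow hca hac).1⟩
  · refine Or.inr ⟨hab', fun c hca hac => hab'.not_gt (hbelow hca hac).2, fun c hbc hac => ?_⟩
    exact hab'.not_gt ((hiff (s.trans' (s.symm' hab) hac) hbc).2 ⟨le_rfl, hbc⟩).1

theorem isNonCrossing_of_forall_exists_sum_Iio_eq_sum_Iic
    (h : ∀ a, ∃ b, s a b ∧ ∀ F, blockSum s F = 0 → ∑ c ∈ Iio a, F c = ∑ c ∈ Iic b, F c) :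
    IsNonCrossing s := by
  classical
  rintro ⟨i, j, k, l, hij, hjk, hkl, hik, hjl, hnij⟩
  obtain ⟨m, hm, hmin⟩ := (univ.filter fun m => k < m ∧ s j m).exists_minimal
    ⟨l, by simpa using ⟨hkl, hjl⟩⟩
  simp only [mem_filter, mem_univ, true_and] at hm hmin
  obtain ⟨hkm, hjm⟩ := hm
  obtain ⟨b, hmb, hb⟩ := h m
  have hjb : s j b := s.trans' hjm hmb
  have hj : b ∈ Set.Ico j m :=
    (mem_Ioc_iff_mem_Ico_of_sum_Iio_eq_sum_Iic hb hjm (hjk.trans hkm)).1 ⟨hjk.trans hkm, le_rfl⟩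
  have hbk : b < k := by
    refine (le_of_not_gt fun hkb => hj.2.not_ge (hmin ⟨hkb, hjb⟩ hj.2.le)).lt_of_ne ?_
    rintro rfl
    exact hnij (s.trans' hik (s.symm' hjb))
  have hm : m ∈ Set.Ioc i k :=
    (mem_Ioc_iff_mem_Ico_of_sum_Iio_eq_sum_Iic hb hik (hij.trans hjk)).2
      ⟨hij.le.trans hj.1, hbk⟩
  exact hkm.not_ge hm.2

end SumIioIic

namespace IsNonCrossing

variable {S : Type*} [LinearOrder S] {s : Setoid S} {a b c d : S}

theorem mem_Ioo_of_rel (hs : IsNonCrossing s) (hab : s a b)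
    (hgap : ∀ c, b < c → c < a → ¬ s a c) (hcd : s c d) (hc : c ∈ Set.Ioo b a) :
    d ∈ Set.Ioo b a := by
  obtain ⟨hbc, hca⟩ := hc
  have hac : ¬ s a c := hgap c hbc hca
  have had : ¬ s a d := fun h => hac (s.trans' h (s.symm' hcd))
  have hda : d ≠ a := fun h => had (h ▸ s.refl' a)
  have hdb : d ≠ b := fun h => had (h ▸ hab)
  refine ⟨lt_of_not_ge fun h => ?_, lt_of_not_ge fun h => ?_⟩
  · exact hs ⟨d, b, c, a, h.lt_of_ne hdb, hbc, hca, s.symm' hcd, s.symm' hab,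
      fun hdb => had (s.trans' hab (s.symm' hdb))⟩
  · exact hs ⟨b, c, a, d, hbc, hca, h.lt_of_ne hda.symm, s.symm' hab, hcd,
      fun hbc => hac (s.trans' hab hbc)⟩

theorem mem_Icc_of_rel (hs : IsNonCrossing s) (hab : s a b) (ha : ∀ c, c < a → ¬ s a c)
    (hb : ∀ c, b < c → ¬ s a c) (hcd : s c d) (hc : c ∈ Set.Icc a b) : d ∈ Set.Icc a b := by
  obtain ⟨hac, hcb⟩ := hc
  by_cases hsac : s a c
  · exact ⟨le_of_not_gt fun h => ha d h (s.trans' hsac hcd),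
      le_of_not_gt fun h => hb d h (s.trans' hsac hcd)⟩
  have hac' : a < c := hac.lt_of_ne fun h => hsac (h ▸ s.refl' a)
  have hcb' : c < b := hcb.lt_of_ne fun h => hsac (h ▸ hab)
  refine ⟨le_of_not_gt fun h => ?_, le_of_not_gt fun h => ?_⟩
  · exact hs ⟨d, a, c, b, h, hac', hcb', s.symm' hcd, hab,
      fun hda => hsac (s.symm' (s.trans' hcd hda))⟩
  · exact hs ⟨a, c, b, d, hac', hcb', h, hab, hcd, hsac⟩

theorem sum_Iio_eq_sum_Iic [Fintype S] [LocallyFiniteOrder S] [LocallyFiniteOrderBot S]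
    (hs : IsNonCrossing s) {F : S → ℚ} (hF : blockSum s F = 0) (hab : CyclicPred s a b) :
    ∑ c ∈ Iio a, F c = ∑ c ∈ Iic b, F c := by
  obtain ⟨hsab, ⟨hba, hgap⟩ | ⟨hle, ha, hb⟩⟩ := hab
  · have hsub : Iic b ⊆ Iio a := fun c hc => mem_Iio.2 ((mem_Iic.1 hc).trans_lt hba)
    rw [← sum_sdiff hsub, show Iio a \ Iic b = Ioo b a by ext; simp [and_comm], add_eq_right]
    exact sum_eq_zero_of_blockSum_eq_zero hF fun c d hcd hc =>
      mem_Ioo.2 (hs.mem_Ioo_of_rel hsab hgap hcd (mem_Ioo.1 hc))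
  · have hsub : Iio a ⊆ Iic b := fun c hc => mem_Iic.2 ((mem_Iio.1 hc).le.trans hle)
    rw [← sum_sdiff hsub, show Iic b \ Iio a = Icc a b by ext; simp [and_comm], right_eq_add]
    exact sum_eq_zero_of_blockSum_eq_zero hF fun c d hcd hc =>
      mem_Icc.2 (hs.mem_Icc_of_rel hsab ha hb hcd (mem_Icc.1 hc))

end IsNonCrossing

namespace RotationSystem

variable {n : ℕ} {Y : Type*}

section Basic

variable (M : RotationSystem n) {x y : Fin (2 * n + 1)}

instance : Finite M.Vertex := Quotient.finite _

instance : Finite M.Face := Quotient.finite _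

theorem vertex_eq_iff : M.vertex x = M.vertex y ↔ M.σ.SameCycle x y :=
  Quotient.eq (r := Equiv.Perm.SameCycle.setoid M.σ)

theorem vertex_surjective : Function.Surjective M.vertex :=
  Quotient.exists_rep

theorem vertex_σ (x : Fin (2 * n + 1)) : M.vertex (M.σ x) = M.vertex x :=
  M.vertex_eq_iff.2 (Equiv.Perm.sameCycle_apply_left.2 (.refl _ _))

theorem α_root : M.α M.root = M.root := (M.α_eq_self_iff _).2 rfl

theorem α_eq_iff : M.α x = y ↔ x = M.α y :=
  ⟨fun h => by rw [← h, M.α_α], fun h => by rw [h, M.α_α]⟩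

theorem facePerm_α (x : Fin (2 * n + 1)) : M.facePerm (M.α x) = M.σ x := by
  rw [facePerm, Equiv.Perm.mul_apply, M.α_α]

/-- The face at the right of a half-edge. -/
def face (h : Fin (2 * n + 1)) : M.Face :=
  Quotient.mk (Equiv.Perm.SameCycle.setoid M.facePerm) h

theorem face_surjective : Function.Surjective M.face :=
  Quotient.exists_rep

theorem face_eq_iff : M.face x = M.face y ↔ M.facePerm.SameCycle x y :=
  Quotient.eq (r := Equiv.Perm.SameCycle.setoid M.facePerm)

theorem face_σ (x : Fin (2 * n + 1)) : M.face (M.σ x) = M.face (M.α x) := by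
  rw [face_eq_iff, ← facePerm_α, Equiv.Perm.sameCycle_apply_left]

theorem card_lt_α : Fintype.card {x // x < M.α x} = n := by
  have hsymm : Fintype.card {x // x < M.α x} = Fintype.card {x // M.α x < x} :=
    Fintype.card_congr (M.α.subtypeEquiv fun x => by rw [M.α_α])
  have hcompl := Fintype.card_subtype_compl fun x => x = M.root
  have hsplit : Fintype.card {x // ¬ x = M.root} =
      Fintype.card {x // x < M.α x} + Fintype.card {x // M.α x < x} := by
    rw [← Fintype.card_subtype_or_disjoint]
    · refine Fintype.card_congr (Equiv.subtypeEquivRight fun x => ?_)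
      rw [← M.α_eq_self_iff, ← ne_eq, ne_comm, lt_or_lt_iff_ne]
    · intro p hp hq x hx
      exact lt_asymm (hp x hx) (hq x hx)
  rw [Fintype.card_fin, Fintype.card_subtype_eq] at hcompl
  omega

/-- Connectedness, as in `IsMap.connected`: `σ` and `α` act transitively on the half-edges. -/
def IsConnected : Prop :=
  ∀ x y, ∃ g ∈ Subgroup.closure {M.σ, M.α}, g x = y

variable {M}

theorem IsConnected.induction (hM : M.IsConnected) {Q : Fin (2 * n + 1) → Prop}
    (root : Q M.root) (σ : ∀ x, Q x → Q (M.σ x)) (α : ∀ x, Q x → Q (M.α x))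
    (x : Fin (2 * n + 1)) : Q x := by
  obtain ⟨g, hg, rfl⟩ := hM M.root x
  suffices Set.MapsTo g {x | Q x} {x | Q x} from this root
  clear root
  induction hg using Subgroup.closure_induction with
  | mem g hg =>
    rcases hg with rfl | rfl
    · exact σ
    · exact α
  | one => exact fun x hx => hx
  | mul g k _ _ hg hk => exact hg.comp hk
  | inv g _ hg => exact Equiv.Perm.perm_symm_mapsTo_of_mapsTo g hg

end Basic

section Hodge

/-! Vertex functions and face functions are treated as in Hodge theory: gradients of vertex
functions and jumps of face functions are orthogonal, on a connected map they determine the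
functions up to constants, and Euler's relation says that together they span all antisymmetric
functions on half-edges. Hence the circulations, which are orthogonal to the gradients, are the
jumps of face functions. -/

variable {M : RotationSystem n} {u w f g : Fin (2 * n + 1) → ℚ}

/-- A function of half-edges that depends only on their vertex. -/
def IsVertexFun (M : RotationSystem n) (u : Fin (2 * n + 1) → Y) : Prop :=
  ∀ x, u (M.σ x) = u x

/-- A function of half-edges that depends only on the face at their right. -/
def IsFaceFun (M : RotationSystem n) (w : Fin (2 * n + 1) → Y) : Prop :=
  ∀ x, w (M.σ x) = w (M.α x)

/-- A flow along the edges that is conserved at each vertex. Conservation is tested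
against the vertex functions, rather than against the indicator functions of vertices. -/
structure IsCirculation (M : RotationSystem n) (f : Fin (2 * n + 1) → ℚ) : Prop where
  apply_α : ∀ x, f (M.α x) = -f x
  sum_mul_eq_zero : ∀ u, M.IsVertexFun u → ∑ x, u x * f x = 0

theorem isVertexFun_comp_vertex (M : RotationSystem n) (u : M.Vertex → Y) :
    M.IsVertexFun fun x => u (M.vertex x) :=
  fun x => congrArg u (M.vertex_σ x)

theorem isFaceFun_comp_face (M : RotationSystem n) (w : M.Face → Y) :
    M.IsFaceFun fun x => w (M.face x) :=
  fun x => congrArg w (M.face_σ x)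

theorem IsVertexFun.apply_eq {u : Fin (2 * n + 1) → Y} (hu : M.IsVertexFun u)
    {x y : Fin (2 * n + 1)} (h : M.vertex x = M.vertex y) : u x = u y :=
  apply_eq_of_sameCycle hu (M.vertex_eq_iff.1 h)

theorem IsFaceFun.apply_facePerm {w : Fin (2 * n + 1) → Y} (hw : M.IsFaceFun w)
    (x : Fin (2 * n + 1)) : w (M.facePerm x) = w x := by
  rw [facePerm, Equiv.Perm.mul_apply, hw, M.α_α]

theorem IsFaceFun.apply_eq {w : Fin (2 * n + 1) → Y} (hw : M.IsFaceFun w)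
    {x y : Fin (2 * n + 1)} (h : M.face x = M.face y) : w x = w y :=
  apply_eq_of_sameCycle hw.apply_facePerm (M.face_eq_iff.1 h)

theorem IsConnected.apply_eq_apply_root (hM : M.IsConnected) {u : Fin (2 * n + 1) → Y}
    (hσ : M.IsVertexFun u) (hα : ∀ x, u (M.α x) = u x) (x : Fin (2 * n + 1)) :
    u x = u M.root :=
  hM.induction (Q := fun x => u x = u M.root) rfl (fun x hx => (hσ x).trans hx)
    (fun x hx => (hα x).trans hx) x

theorem sum_gradient_mul_jump_eq_zero (hu : M.IsVertexFun u) (hw : M.IsFaceFun w) :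
    ∑ x, (u (M.α x) - u x) * (w (M.α x) - w x) = 0 := by
  have hαα : ∑ x, u (M.α x) * w (M.α x) = ∑ x, u x * w x :=
    Equiv.sum_comp M.α fun x => u x * w x
  have hα : ∑ x, u (M.α x) * w x = ∑ x, u x * w (M.α x) := by
    rw [← Equiv.sum_comp M.α]
    simp only [M.α_α]
  have hσ : ∑ x, u x * w (M.α x) = ∑ x, u x * w x := by
    rw [← Equiv.sum_comp M.σ fun x => u x * w x]
    exact sum_congr rfl fun x _ => by rw [hu, hw]
  calc ∑ x, (u (M.α x) - u x) * (w (M.α x) - w x)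
      = ∑ x, (u (M.α x) * w (M.α x) - u (M.α x) * w x - u x * w (M.α x) + u x * w x) :=
        sum_congr rfl fun x _ => by ring
    _ = 0 := by
        rw [sum_add_distrib, sum_sub_distrib, sum_sub_distrib, hαα, hα, hσ]; ring

theorem gradient_eq_zero_of_orthogonal (hu : M.IsVertexFun u) (hw : M.IsFaceFun w)
    (h : ∑ x, (u (M.α x) - u x) * ((u (M.α x) - u x) + (w (M.α x) - w x)) = 0)
    (x : Fin (2 * n + 1)) : u (M.α x) = u x := by
  simp only [mul_add, sum_add_distrib, sum_gradient_mul_jump_eq_zero hu hw, add_zero] at h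
  have hsq := (sum_eq_zero_iff_of_nonneg fun x _ => mul_self_nonneg _).1 h x (mem_univ _)
  exact sub_eq_zero.1 (mul_self_eq_zero.1 hsq)

theorem eq_of_antisymm (hf : ∀ x, f (M.α x) = -f x) (hg : ∀ x, g (M.α x) = -g x)
    (h : ∀ x, x < M.α x → f x = g x) (x : Fin (2 * n + 1)) : f x = g x := by
  rcases lt_trichotomy x (M.α x) with hx | hx | hx
  · exact h x hx
  · have hfx := hf x
    have hgx := hg x
    rw [← hx] at hfx hgx
    linarith
  · have := h (M.α x) (by rwa [M.α_α])
    rwa [hf, hg, neg_inj] at this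

/-- The sum of the gradient of a vertex function and of the jump of a face function, together with
their values at the root. As a gradient or a jump is antisymmetric, it is recorded on one
half of each edge only. -/
noncomputable def hodgeMap (M : RotationSystem n) :
    ((M.Vertex → ℚ) × (M.Face → ℚ)) →ₗ[ℚ] ({x // x < M.α x} → ℚ) × ℚ × ℚ where
  toFun p := (fun x => (p.1 (M.vertex (M.α x)) - p.1 (M.vertex x)) +
    (p.2 (M.face (M.α x)) - p.2 (M.face x)), p.1 (M.vertex M.root), p.2 (M.face M.root))
  map_add' p q := by
    refine Prod.ext (funext fun x => ?_) rfl
    simp only [Prod.fst_add, Prod.snd_add, Pi.add_apply]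
    ring
  map_smul' c p := by
    refine Prod.ext (funext fun x => ?_) rfl
    simp only [Prod.smul_fst, Prod.smul_snd, Pi.smul_apply, smul_eq_mul, RingHom.id_apply]
    ring

theorem gradient_add_jump_eq_of_hodgeMap_eq {u : M.Vertex → ℚ} {w : M.Face → ℚ} {a b : ℚ}
    (hf : ∀ x, f (M.α x) = -f x) (h : M.hodgeMap (u, w) = (fun x => f x.1, a, b))
    (x : Fin (2 * n + 1)) :
    (u (M.vertex (M.α x)) - u (M.vertex x)) + (w (M.face (M.α x)) - w (M.face x)) = f x :=
  M.eq_of_antisymm (f := fun x => (u (M.vertex (M.α x)) - u (M.vertex x)) +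
    (w (M.face (M.α x)) - w (M.face x))) (fun x => by rw [M.α_α]; ring) hf
    (fun x hx => congrFun (congrArg Prod.fst h) ⟨x, hx⟩) x

theorem IsConnected.hodgeMap_injective (hM : M.IsConnected) :
    Function.Injective M.hodgeMap := by
  refine (injective_iff_map_eq_zero _).2 fun ⟨u, w⟩ hp => ?_
  have hsum := gradient_add_jump_eq_of_hodgeMap_eq (M := M) (f := 0) (by simp) hp
  have hgrad := gradient_eq_zero_of_orthogonal (M.isVertexFun_comp_vertex u)
    (M.isFaceFun_comp_face w) (by simp only [hsum, Pi.zero_apply, mul_zero, sum_const_zero])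
  have hu (x) : u (M.vertex x) = 0 :=
    (hM.apply_eq_apply_root (M.isVertexFun_comp_vertex u) hgrad x).trans
      (congrArg (fun p => p.2.1) hp)
  have hjump (x) : w (M.face (M.α x)) = w (M.face x) := by
    have := hsum x
    rwa [hgrad, sub_self, zero_add, Pi.zero_apply, sub_eq_zero] at this
  have hw (x) : w (M.face x) = 0 :=
    (hM.apply_eq_apply_root (u := fun x => w (M.face x))
      (fun x => (M.isFaceFun_comp_face w x).trans (hjump x)) hjump x).trans
      (congrArg (fun p => p.2.2) hp)
  exact Prod.ext (funext (M.vertex_surjective.forall.2 hu))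
    (funext (M.face_surjective.forall.2 hw))

theorem finrank_vertexFun_prod_faceFun (M : RotationSystem n) :
    Module.finrank ℚ ((M.Vertex → ℚ) × (M.Face → ℚ)) = Nat.card M.Vertex + Nat.card M.Face := by
  have := Fintype.ofFinite M.Vertex
  have := Fintype.ofFinite M.Face
  simp [Module.finrank_prod, Nat.card_eq_fintype_card]

theorem finrank_hodgeMap_codomain (M : RotationSystem n) :
    Module.finrank ℚ (({x // x < M.α x} → ℚ) × ℚ × ℚ) = n + 2 := by
  rw [Module.finrank_prod, Module.finrank_prod, Module.finrank_fintype_fun_eq_card, M.card_lt_α,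
    Module.finrank_self]

theorem IsConnected.card_vertex_add_card_face_le (hM : M.IsConnected) :
    Nat.card M.Vertex + Nat.card M.Face ≤ n + 2 := by
  rw [← M.finrank_vertexFun_prod_faceFun, ← M.finrank_hodgeMap_codomain]
  exact LinearMap.finrank_le_finrank_of_injective hM.hodgeMap_injective

theorem IsMap.exists_isFaceFun_jump_eq (hM : M.IsMap) (hf : M.IsCirculation f) :
    ∃ w : Fin (2 * n + 1) → ℚ, M.IsFaceFun w ∧ ∀ x, w (M.α x) - w x = f x := by
  have hsurj : Function.Surjective M.hodgeMap :=
    (LinearMap.injective_iff_surjective_of_finrank_eq_finrank (by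
      rw [finrank_vertexFun_prod_faceFun, finrank_hodgeMap_codomain, hM.euler])).1
      (IsConnected.hodgeMap_injective hM.connected)
  obtain ⟨⟨u, w⟩, hp⟩ := hsurj (fun x => f x.1, 0, 0)
  have hsum := gradient_add_jump_eq_of_hodgeMap_eq hf.apply_α hp
  have hu : ∑ x, u (M.vertex x) * f x = 0 :=
    hf.sum_mul_eq_zero _ (M.isVertexFun_comp_vertex u)
  have huα : ∑ x, u (M.vertex (M.α x)) * f x = 0 := by
    rw [← Equiv.sum_comp M.α]
    simp only [M.α_α, hf.apply_α, mul_neg, sum_neg_distrib, hu, neg_zero]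
  have hgrad := gradient_eq_zero_of_orthogonal (M.isVertexFun_comp_vertex u)
    (M.isFaceFun_comp_face w) (by
      simp only [hsum, sub_mul, sum_sub_distrib, hu, huα, sub_zero])
  refine ⟨_, M.isFaceFun_comp_face w, fun x => ?_⟩
  rw [← hsum x, hgrad, sub_self, zero_add]

end Hodge

section Flow

variable {M : RotationSystem n} {ι : Type*} [Fintype ι] {c : ι → Fin (2 * n + 1)}
  {x y : Fin (2 * n + 1)}

/-- The flow that carries one unit along each of the half-edges `c i`, from its vertex to the other
end of its edge. -/
def flow (M : RotationSystem n) (c : ι → Fin (2 * n + 1)) (x : Fin (2 * n + 1)) : ℚ :=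
  ∑ i, ((if c i = x then 1 else 0) - if c i = M.α x then 1 else 0)

theorem isCirculation_flow (e : Equiv.Perm ι)
    (he : ∀ i, M.vertex (M.α (c i)) = M.vertex (c (e i))) : M.IsCirculation (M.flow c) where
  apply_α x := by simp only [flow, M.α_α, ← sum_neg_distrib, neg_sub]
  sum_mul_eq_zero u hu := by
    have hterm (i : ι) : ∑ x, u x * ((if c i = x then 1 else 0) - if c i = M.α x then 1 else 0) =
        u (c i) - u (c (e i)) := by
      simp [mul_sub, ← hu.apply_eq (he i), ← M.α_eq_iff]
    simp only [flow, mul_sum]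
    rw [sum_comm, sum_congr rfl fun i _ => hterm i, sum_sub_distrib,
      Equiv.sum_comp e fun i => u (c i), sub_self]

theorem flow_nonneg (hx : ∀ i, c i ≠ M.α x) : 0 ≤ M.flow c x :=
  sum_nonneg fun i _ => by
    rw [if_neg (hx i), sub_zero]
    split_ifs <;> simp

theorem flow_eq_zero (hx : x ∉ Set.range c) (hαx : M.α x ∉ Set.range c) : M.flow c x = 0 :=
  sum_eq_zero fun i _ => by
    rw [if_neg fun h => hx ⟨i, h⟩, if_neg fun h => hαx ⟨i, h⟩, sub_self]

theorem flow_apply_self (hinj : Function.Injective c) (hα : ∀ i j, c i ≠ M.α (c j)) (i : ι) :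
    M.flow c (c i) = 1 := by
  classical
  simp [flow, hα, hinj.eq_iff]

/-- The half-edges `x` and `y` have the same face at their right, or the faces at their right are
separated by an edge with no half in `S`; see `OrientedSystem.AvoidStep`. -/
def FaceStep (M : RotationSystem n) (S : Set (Fin (2 * n + 1))) (x y : Fin (2 * n + 1)) : Prop :=
  y = M.facePerm x ∨ (y = M.α x ∧ x ∉ S ∧ M.α x ∉ S)

variable {S : Set (Fin (2 * n + 1))}

theorem IsFaceFun.apply_eq_of_eqvGen {w : Fin (2 * n + 1) → Y} (hw : M.IsFaceFun w)
    (hS : ∀ x, x ∉ S → M.α x ∉ S → w (M.α x) = w x)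
    (h : Relation.EqvGen (M.FaceStep S) x y) : w x = w y := by
  refine (eq_equivalence.comap w).eqvGen_iff.1 (h.mono ?_)
  rintro x _ (rfl | ⟨rfl, hx, hαx⟩)
  · exact (hw.apply_facePerm x).symm
  · exact (hS x hx hαx).symm

theorem IsConnected.exists_eqvGen_root (hM : M.IsConnected) (hS : S.Nonempty) :
    ∃ x, Relation.EqvGen (M.FaceStep S) x M.root ∧ (x ∈ S ∨ M.α x ∈ S) := by
  by_contra! hout
  have hα (x) (hx : Relation.EqvGen (M.FaceStep S) x M.root) :
      Relation.EqvGen (M.FaceStep S) (M.α x) M.root :=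
    .trans _ _ _ (.symm _ _ (.rel _ _ (Or.inr ⟨rfl, hout x hx⟩))) hx
  have hσ (x) (hx : Relation.EqvGen (M.FaceStep S) x M.root) :
      Relation.EqvGen (M.FaceStep S) (M.σ x) M.root :=
    .trans _ _ _ (.symm _ _ (.rel (M.α x) _ (Or.inl (M.facePerm_α x).symm))) (hα x hx)
  obtain ⟨x, hx⟩ := hS
  exact (hout x (hM.induction (.refl _) hσ hα x)).1 hx

end Flow

end RotationSystem

theorem exists_adj_dist_lt {V : Type*} {G : SimpleGraph V} {r v : V} (h : G.Reachable r v)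
    (hv : v ≠ r) : ∃ u, G.Adj v u ∧ G.dist r u < G.dist r v := by
  obtain ⟨p, hp⟩ := h.symm.exists_walk_length_eq_dist
  obtain ⟨u, hadj, q, rfl⟩ := p.exists_eq_cons_of_ne hv
  refine ⟨u, hadj, ?_⟩
  rw [G.dist_comm, G.dist_comm (u := r), ← hp, SimpleGraph.Walk.length_cons, Nat.lt_succ_iff]
  exact SimpleGraph.dist_le q

namespace RotationSystem

variable {n : ℕ} {M : RotationSystem n}

theorem IsConnected.reachable_root (hM : M.IsConnected) (x : Fin (2 * n + 1)) :
    M.graph.Reachable (M.vertex M.root) (M.vertex x) := by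
  refine hM.induction (Q := fun x => M.graph.Reachable (M.vertex M.root) (M.vertex x)) (.refl _)
    (fun x hx => by rwa [M.vertex_σ]) (fun x hx => ?_) x
  by_cases h : M.vertex x = M.vertex (M.α x)
  · rwa [← h]
  · exact hx.trans (SimpleGraph.Adj.reachable
      ((SimpleGraph.fromRel_adj _ _ _).2 ⟨h, Or.inl ⟨x, rfl, rfl⟩⟩))

theorem IsConnected.exists_depth_lt (hM : M.IsConnected) {v : M.Vertex}
    (hv : v ≠ M.vertex M.root) :
    ∃ x, M.vertex x = v ∧ M.depth (M.vertex (M.α x)) < M.depth v := by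
  obtain ⟨y, rfl⟩ := M.vertex_surjective v
  obtain ⟨u, hadj, hlt⟩ := exists_adj_dist_lt (hM.reachable_root y) hv
  obtain ⟨-, ⟨x, hx, rfl⟩ | ⟨x, rfl, hx⟩⟩ := (SimpleGraph.fromRel_adj _ _ _).1 hadj
  · exact ⟨x, hx, hlt⟩
  · exact ⟨M.α x, hx, by rwa [M.α_α]⟩

theorem IsTree.card_vertex (hM : M.IsTree) : Nat.card M.Vertex = n + 1 := by
  have heuler := hM.isMap.euler
  have hface := hM.card_face
  omega

end RotationSystem

namespace OrientedSystem

variable {n : ℕ} {M : OrientedSystem n} {x : Fin (2 * n + 1)}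

namespace IsOriented

theorem ne_root (hM : M.IsOriented) (hx : ¬ M.isHead x) : x ≠ M.root :=
  fun h => hx (h ▸ hM.root_isHead)

theorem isHead_α_of_not_isHead (hM : M.IsOriented) (hx : ¬ M.isHead x) : M.isHead (M.α x) :=
  (hM.isHead_α x (hM.ne_root hx)).2 hx

theorem not_isHead_α (hM : M.IsOriented) (hr : x ≠ M.root) (hx : M.isHead x) :
    ¬ M.isHead (M.α x) :=
  fun h => (hM.isHead_α x hr).1 h hx

theorem ncard_heads (hM : M.IsOriented) : {x | M.isHead x}.ncard = n + 1 := by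
  have himage : M.α '' ({x | M.isHead x} \ {M.root}) = {x | M.isHead x}ᶜ := by
    refine Set.Subset.antisymm ?_ fun x hx => ⟨M.α x, ⟨hM.isHead_α_of_not_isHead hx, fun h => ?_⟩,
      M.α_α x⟩
    · rintro _ ⟨x, ⟨hx, hr⟩, rfl⟩
      exact hM.not_isHead_α hr hx
    · exact hM.ne_root hx (by rw [← M.α_root, ← M.α_eq_iff, h])
  have hcard := congrArg Set.ncard himage
  rw [Set.ncard_image_of_injective _ M.α.injective] at hcard
  have hroot := Set.ncard_sdiff_singleton_add_one (s := {x | M.isHead x}) hM.root_isHead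
  have htotal := Set.ncard_add_ncard_compl {x | M.isHead x}
  rw [Nat.card_fin] at htotal
  omega

end IsOriented

theorem isOriented_of_le_ncard_heads (hroot : M.isHead M.root)
    (hα : ∀ x, x ≠ M.root → M.isHead x → ¬ M.isHead (M.α x))
    (hcard : n + 1 ≤ {x | M.isHead x}.ncard) : M.IsOriented := by
  have hsub : M.α '' ({x | M.isHead x} \ {M.root}) ⊆ {x | M.isHead x}ᶜ := by
    rintro _ ⟨x, ⟨hx, hr⟩, rfl⟩
    exact hα x hr hx
  have himage := Set.eq_of_subset_of_ncard_le hsub <| by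
    rw [Set.ncard_image_of_injective _ M.α.injective]
    have hdiff := Set.ncard_sdiff_singleton_add_one (s := {x | M.isHead x}) hroot
    have htotal := Set.ncard_add_ncard_compl {x | M.isHead x}
    rw [Nat.card_fin] at htotal
    omega
  refine ⟨hroot, fun x hr => ⟨fun hαx hx => hα x hr hx hαx, fun hx => ?_⟩⟩
  obtain ⟨y, ⟨hy, -⟩, rfl⟩ := himage.symm.subset hx
  rwa [M.α_α]

theorem reachable_induction (hM : ∀ v, Relation.ReflTransGen M.Arc (M.vertex M.root) v)
    {Q : Fin (2 * n + 1) → Prop} (root : Q M.root) (σ : ∀ x, Q (M.σ x) → Q x)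
    (arc : ∀ t, ¬ M.isHead t → Q t → Q (M.α t)) (x : Fin (2 * n + 1)) : Q x := by
  have hvertex {x y} (h : M.vertex x = M.vertex y) (hx : Q x) : Q y :=
    mem_of_sameCycle (π := M.σ⁻¹) (s := {x | Q x})
      (fun x hx => σ _ (by rwa [← Equiv.Perm.mul_apply, mul_inv_cancel]))
      (Equiv.Perm.sameCycle_inv.2 (M.vertex_eq_iff.1 h)) hx
  suffices ∀ v x, M.vertex x = v → Q x from this _ x rfl
  intro v
  induction hM v with
  | refl => exact fun x hx => hvertex hx.symm root
  | tail _ harc ih =>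
    obtain ⟨t, ht, htv, rfl⟩ := harc
    exact fun x hx => hvertex hx.symm (arc t ht (ih t htv))

theorem isConnected_of_reachable
    (hM : ∀ v, Relation.ReflTransGen M.Arc (M.vertex M.root) v) : M.IsConnected := by
  let G := Subgroup.closure {M.σ, M.α}
  have hσ : M.σ ∈ G := Subgroup.subset_closure (Or.inl rfl)
  have hα : M.α ∈ G := Subgroup.subset_closure (Or.inr rfl)
  have horbit : ∀ x, ∃ g ∈ G, g M.root = x := by
    refine reachable_induction hM ⟨1, one_mem _, rfl⟩ ?_ ?_
    · rintro x ⟨g, hg, hgx⟩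
      exact ⟨M.σ⁻¹ * g, mul_mem (inv_mem hσ) hg, by simp [hgx]⟩
    · rintro t - ⟨g, hg, rfl⟩
      exact ⟨M.α * g, mul_mem hα hg, rfl⟩
  intro x y
  obtain ⟨g, hg, rfl⟩ := horbit x
  obtain ⟨k, hk, rfl⟩ := horbit y
  exact ⟨k * g⁻¹, mul_mem hk (inv_mem hg), by simp⟩

end OrientedSystem

namespace RotationSystem

variable {n : ℕ} {T : RotationSystem n} {hd hd' : Fin (2 * n + 1) → Prop} {x y : Fin (2 * n + 1)}

/-- With the half-edges of `hd` as heads, `T` is a plane tree oriented from the root to the leaves: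
every vertex is the end of exactly one head and is reached from the root by a directed path. -/
structure IsArborescence (T : RotationSystem n) (hd : Fin (2 * n + 1) → Prop) : Prop where
  isOriented : (OrientedSystem.mk T hd).IsOriented
  existsUnique_head : ∀ v, ∃! h, hd h ∧ T.vertex h = v
  reachable : ∀ v, Relation.ReflTransGen (OrientedSystem.mk T hd).Arc (T.vertex T.root) v

namespace IsArborescence

theorem head_unique (hT : T.IsArborescence hd) (hx : hd x) (hy : hd y)
    (h : T.vertex x = T.vertex y) : x = y :=
  (hT.existsUnique_head (T.vertex y)).unique ⟨hx, h⟩ ⟨hy, rfl⟩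

theorem head_induction (hT : T.IsArborescence hd) {Q : Fin (2 * n + 1) → Prop} (root : Q T.root)
    (parent : ∀ h g, hd h → hd g → T.vertex (T.α h) = T.vertex g → Q g → Q h)
    (h : Fin (2 * n + 1)) (hh : hd h) : Q h := by
  suffices ∀ v, ∀ h, hd h → T.vertex h = v → Q h from this _ h hh rfl
  intro v
  induction hT.reachable v with
  | refl => exact fun h hh hv => hT.head_unique hh hT.isOriented.root_isHead hv ▸ root
  | tail _ harc ih =>
    obtain ⟨t, ht, rfl, rfl⟩ := harc
    intro h hh hv
    obtain ⟨g, ⟨hg, hgt⟩, -⟩ := hT.existsUnique_head (T.vertex t)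
    obtain rfl := hT.head_unique hh (hT.isOriented.isHead_α_of_not_isHead ht) hv
    exact parent _ g hh hg ((congrArg T.vertex (T.α_α t)).trans hgt.symm) (ih g hg hgt)

theorem isHead_of_isHead (hT : T.IsArborescence hd) (hT' : T.IsArborescence hd')
    (h : Fin (2 * n + 1)) (hh : hd h) : hd' h := by
  refine hT.head_induction hT'.isOriented.root_isHead (fun h g hh _ hv hg' => ?_) h hh
  by_contra hh'
  have hαh : T.α h = g := hT'.head_unique (hT'.isOriented.isHead_α_of_not_isHead hh') hg' hv
  exact hT.isOriented.not_isHead_α (hT'.isOriented.ne_root hh') hh (hαh ▸ ‹hd g›)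

theorem unique (hT : T.IsArborescence hd) (hT' : T.IsArborescence hd') : hd = hd' :=
  funext fun h => propext ⟨hT.isHead_of_isHead hT' h, hT'.isHead_of_isHead hT h⟩

theorem isTree (hT : T.IsArborescence hd) : T.IsTree := by
  have hconn : T.IsConnected := OrientedSystem.isConnected_of_reachable (M := ⟨T, hd⟩) hT.reachable
  have hbij : Function.Bijective fun h : {h | hd h} => T.vertex h :=
    ⟨fun h g hv => Subtype.ext (hT.head_unique h.2 g.2 hv), fun v =>
      let ⟨h, ⟨hh, hv⟩, _⟩ := hT.existsUnique_head v
      ⟨⟨h, hh⟩, hv⟩⟩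
  have hvertex : Nat.card T.Vertex = n + 1 := by
    rw [← Nat.card_eq_of_bijective _ hbij, Nat.card_coe_set_eq]
    exact hT.isOriented.ncard_heads
  have : Nonempty T.Face := ⟨T.face T.root⟩
  have hface : Nat.card T.Face = 1 := by
    have hle := hconn.card_vertex_add_card_face_le
    have hpos : 0 < Nat.card T.Face := Nat.card_pos
    omega
  exact ⟨⟨hconn, by rw [hvertex, hface]⟩, hface⟩

end IsArborescence

namespace IsTree

theorem isOriented_and_bijective_vertex (hT : T.IsTree) (hroot : hd T.root)
    (hα : ∀ x, x ≠ T.root → hd x → ¬ hd (T.α x))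
    (hsurj : Function.Surjective fun h : {h | hd h} => T.vertex h) :
    (OrientedSystem.mk T hd).IsOriented ∧
      Function.Bijective fun h : {h | hd h} => T.vertex h := by
  have horiented : (OrientedSystem.mk T hd).IsOriented := by
    refine OrientedSystem.isOriented_of_le_ncard_heads hroot hα ?_
    rw [← hT.card_vertex, ← Nat.card_coe_set_eq]
    exact Nat.card_le_card_of_surjective _ hsurj
  refine ⟨horiented, (Nat.bijective_iff_surjective_and_card _).2 ⟨hsurj, ?_⟩⟩
  rw [hT.card_vertex, Nat.card_coe_set_eq]
  exact horiented.ncard_heads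

theorem isArborescence (hT : T.IsTree) :
    T.IsArborescence fun h => h = T.root ∨ T.depth (T.vertex (T.α h)) < T.depth (T.vertex h) := by
  set hd : Fin (2 * n + 1) → Prop := fun h =>
    h = T.root ∨ T.depth (T.vertex (T.α h)) < T.depth (T.vertex h)
  have hparent {v} (hv : v ≠ T.vertex T.root) :
      ∃ x, hd x ∧ T.vertex x = v ∧ T.depth (T.vertex (T.α x)) < T.depth v := by
    obtain ⟨x, rfl, hx⟩ := IsConnected.exists_depth_lt hT.isMap.connected hv
    exact ⟨x, Or.inr hx, rfl, hx⟩
  obtain ⟨horiented, hbij⟩ := hT.isOriented_and_bijective_vertex (hd := hd) (Or.inl rfl)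
    (by
      rintro x hr (rfl | hx) (hαx | hαx)
      · exact hr rfl
      · exact hr rfl
      · exact hr (by rw [← T.α_root, ← T.α_eq_iff, hαx])
      · rw [T.α_α] at hαx
        exact lt_asymm hx hαx)
    (fun v => by
      by_cases hv : v = T.vertex T.root
      · exact ⟨⟨T.root, Or.inl rfl⟩, hv.symm⟩
      · obtain ⟨x, hx, hxv, -⟩ := hparent hv
        exact ⟨⟨x, hx⟩, hxv⟩)
  refine ⟨horiented, fun v => ?_, fun v => ?_⟩
  · obtain ⟨h, hv, huniq⟩ := hbij.existsUnique v
    exact ⟨h, ⟨h.2, hv⟩, fun g hg => congrArg Subtype.val (huniq ⟨g, hg.1⟩ hg.2)⟩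
  · induction hk : T.depth v using Nat.strong_induction_on generalizing v with
    | _ k ih =>
      by_cases hv : v = T.vertex T.root
      · exact hv ▸ .refl
      · obtain ⟨x, hx, rfl, hlt⟩ := hparent hv
        have hr : x ≠ T.root := fun h => hv (congrArg T.vertex h)
        exact (ih _ (hk ▸ hlt) _ rfl).tail
          ⟨T.α x, horiented.not_isHead_α hr hx, rfl, congrArg T.vertex (T.α_α x)⟩

end IsTree

theorem corner_zero (T : RotationSystem n) : T.corner 0 = T.root := by
  rw [corner, pow_zero, Equiv.Perm.one_apply, T.α_root]

theorem corner_succ (T : RotationSystem n) (j : ℕ) :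
    T.corner (j + 1) = T.α (T.σ (T.corner j)) := by
  rw [corner, corner, pow_succ', Equiv.Perm.mul_apply]
  rfl

theorem exists_isFirstVisit_le (T : RotationSystem n) (j : ℕ) :
    ∃ i ≤ j, T.IsFirstVisit i ∧ T.vertex (T.corner i) = T.vertex (T.corner j) := by
  classical
  have hex : ∃ i, T.vertex (T.corner i) = T.vertex (T.corner j) := ⟨j, rfl⟩
  exact ⟨Nat.find hex, Nat.find_min' hex rfl,
    fun i hi h => Nat.find_min hex hi (h.trans (Nat.find_spec hex)), Nat.find_spec hex⟩

theorem IsArborescence.isHead_corner (hT : T.IsArborescence hd) {j : ℕ}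
    (hj : T.IsFirstVisit j) : hd (T.corner j) := by
  induction j using Nat.strong_induction_on with
  | _ j ih =>
    rcases j with _ | j
    · rw [corner_zero]
      exact hT.isOriented.root_isHead
    by_contra htail
    have hσ : T.α (T.corner (j + 1)) = T.σ (T.corner j) := by rw [corner_succ, T.α_α]
    obtain ⟨i, hij, hi, hv⟩ := T.exists_isFirstVisit_le j
    have hentry : T.corner i = T.α (T.corner (j + 1)) :=
      hT.head_unique (ih i (Nat.lt_succ_of_le hij) hi)
        (hT.isOriented.isHead_α_of_not_isHead htail) (by rw [hσ, T.vertex_σ, hv])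
    rcases i with _ | i
    · rw [corner_zero, eq_comm, T.α_eq_iff, T.α_root] at hentry
      exact hT.isOriented.ne_root htail hentry
    · rw [corner_succ, T.α.injective.eq_iff] at hentry
      exact hj i (by omega) (by rw [← hentry, T.vertex_σ])

end RotationSystem

namespace RotationSystem

variable {n : ℕ}

/-- The first time at which the tour meets a corner. -/
noncomputable def cornerTime (T : RotationSystem n) (x : Fin (2 * n + 1)) : ℕ :=
  sInf {t | T.corner t = x}

/-- At a half-edge `x`, the sum of a function over the vertices met by the tour before it follows
the edge of `x`. -/
noncomputable def tourSum (T : RotationSystem n) :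
    (Fin (n + 1) → ℚ) →ₗ[ℚ] Fin (2 * n + 1) → ℚ :=
  LinearMap.pi fun x =>
    ∑ b with T.cornerTime (T.firstCorner b) < T.cornerTime (T.α x), LinearMap.proj b

theorem tourSum_apply (T : RotationSystem n) (F : Fin (n + 1) → ℚ) (x : Fin (2 * n + 1)) :
    T.tourSum F x = ∑ b with T.cornerTime (T.firstCorner b) < T.cornerTime (T.α x), F b := by
  simp [tourSum]

namespace IsTree

variable {T : RotationSystem n} (hT : T.IsTree)
include hT

theorem isCycleOn_facePerm : T.facePerm.IsCycleOn (univ : Finset (Fin (2 * n + 1))) := by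
  have hface : Subsingleton T.Face := (Nat.card_eq_one_iff_unique.1 hT.card_face).1
  exact ⟨by simp, fun x _ y _ => T.face_eq_iff.1 (Subsingleton.elim _ _)⟩

theorem corner_eq_corner_iff {s t : ℕ} : T.corner s = T.corner t ↔ s ≡ t [MOD 2 * n + 1] := by
  rw [corner, corner, T.α.injective.eq_iff,
    hT.isCycleOn_facePerm.pow_apply_eq_pow_apply (mem_univ _), card_univ, Fintype.card_fin]

theorem exists_corner_eq (x : Fin (2 * n + 1)) : ∃ t < 2 * n + 1, T.corner t = x := by
  obtain ⟨t, hlt, ht⟩ :=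
    hT.isCycleOn_facePerm.exists_pow_eq (mem_univ T.root) (mem_univ (T.α x))
  rw [card_univ, Fintype.card_fin] at hlt
  exact ⟨t, hlt, by rw [corner, ht, T.α_α]⟩

theorem corner_cornerTime (x : Fin (2 * n + 1)) : T.corner (T.cornerTime x) = x :=
  let ⟨t, _, ht⟩ := hT.exists_corner_eq x
  Nat.sInf_mem (s := {t | T.corner t = x}) ⟨t, ht⟩

theorem cornerTime_lt (x : Fin (2 * n + 1)) : T.cornerTime x < 2 * n + 1 :=
  let ⟨_, hlt, ht⟩ := hT.exists_corner_eq x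
  (Nat.sInf_le (s := {t | T.corner t = x}) ht).trans_lt hlt

theorem cornerTime_injective : Function.Injective T.cornerTime :=
  Function.LeftInverse.injective hT.corner_cornerTime

theorem cornerTime_corner {t : ℕ} (ht : t < 2 * n + 1) : T.cornerTime (T.corner t) = t :=
  (hT.corner_eq_corner_iff.1 (hT.corner_cornerTime _)).eq_of_lt_of_lt (hT.cornerTime_lt _) ht

theorem cornerTime_α_σ (x : Fin (2 * n + 1)) :
    T.cornerTime (T.α (T.σ x)) = if T.cornerTime x = 2 * n then 0 else T.cornerTime x + 1 := by
  have hlt := hT.cornerTime_lt x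
  have hnext : T.α (T.σ x) = T.corner (T.cornerTime x + 1) := by
    rw [corner_succ, hT.corner_cornerTime]
  split_ifs with hlast
  · have hwrap : T.corner (2 * n + 1) = T.corner 0 :=
      hT.corner_eq_corner_iff.2 (by simp [Nat.ModEq])
    rw [hnext, hlast, hwrap, hT.cornerTime_corner (by omega)]
  · rw [hnext, hT.cornerTime_corner (by omega)]

theorem lt_of_isFirstVisit {j : ℕ} (hj : T.IsFirstVisit j) : j < 2 * n + 1 := by
  by_contra! hle
  exact hj (j % (2 * n + 1)) ((Nat.mod_lt _ (by omega)).trans_le hle)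
    (congrArg T.vertex (hT.corner_eq_corner_iff.2 (Nat.mod_modEq _ _)))

theorem finite_isFirstVisit : {j | T.IsFirstVisit j}.Finite :=
  (Set.finite_Iio (2 * n + 1)).subset fun _ => hT.lt_of_isFirstVisit

theorem lt_card_isFirstVisit (i : Fin (n + 1)) : (i : ℕ) < #hT.finite_isFirstVisit.toFinset := by
  -- Past the last first visit `Nat.nth` has the junk value `0`, the first visit of vertex `0`.
  by_contra! hle
  have hzero : T.IsFirstVisit 0 := fun i hi => absurd hi (Nat.not_lt_zero i)
  have hi : i = 0 := hT.firstCorner_injective <| by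
    rw [firstCorner, firstCorner, Nat.nth_of_card_le _ hle, Fin.val_zero,
      Nat.nth_zero_of_zero hzero]
  rw [hi, Fin.val_zero, Nat.le_zero, card_eq_zero] at hle
  exact notMem_empty 0 (hle ▸ hT.finite_isFirstVisit.mem_toFinset.2 hzero)

theorem isFirstVisit_nth (i : Fin (n + 1)) : T.IsFirstVisit (Nat.nth T.IsFirstVisit i) :=
  Nat.nth_mem _ fun _ => hT.lt_card_isFirstVisit i

theorem cornerTime_firstCorner (i : Fin (n + 1)) :
    T.cornerTime (T.firstCorner i) = Nat.nth T.IsFirstVisit i :=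
  hT.cornerTime_corner (hT.lt_of_isFirstVisit (hT.isFirstVisit_nth i))

theorem strictMono_cornerTime_firstCorner :
    StrictMono fun i => T.cornerTime (T.firstCorner i) := by
  intro i j hij
  simp only [hT.cornerTime_firstCorner]
  exact Nat.nth_strictMonoOn hT.finite_isFirstVisit (hT.lt_card_isFirstVisit i)
    (hT.lt_card_isFirstVisit j) hij

theorem mem_range_firstCorner_iff {hd : Fin (2 * n + 1) → Prop} (hA : T.IsArborescence hd)
    {x : Fin (2 * n + 1)} : x ∈ Set.range T.firstCorner ↔ hd x := by
  have hsub : Set.range T.firstCorner ⊆ {x | hd x} := by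
    rintro _ ⟨i, rfl⟩
    exact hA.isHead_corner (hT.isFirstVisit_nth i)
  have hcard : {x | hd x}.ncard ≤ (Set.range T.firstCorner).ncard := by
    rw [← Set.image_univ, Set.ncard_image_of_injective _ hT.firstCorner_injective, Set.ncard_univ,
      Nat.card_fin]
    exact hA.isOriented.ncard_heads.le
  rw [Set.eq_of_subset_of_ncard_le hsub hcard]
  rfl

theorem isHead_firstCorner {hd : Fin (2 * n + 1) → Prop} (hA : T.IsArborescence hd)
    (i : Fin (n + 1)) : hd (T.firstCorner i) :=
  (hT.mem_range_firstCorner_iff hA).1 ⟨i, rfl⟩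

theorem tourSum_α_firstCorner (F : Fin (n + 1) → ℚ) (a : Fin (n + 1)) :
    T.tourSum F (T.α (T.firstCorner a)) = ∑ b ∈ Iio a, F b := by
  rw [tourSum_apply, T.α_α]
  refine sum_congr ?_ fun _ _ => rfl
  ext b
  simp [hT.strictMono_cornerTime_firstCorner.lt_iff_lt]

variable {F : Fin (n + 1) → ℚ}

theorem tourSum_σ (hF : ∑ b, F b = 0) (x : Fin (2 * n + 1)) :
    T.tourSum F (T.σ x) = ∑ b with T.cornerTime (T.firstCorner b) ≤ T.cornerTime x, F b := by
  rw [tourSum_apply, hT.cornerTime_α_σ]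
  split_ifs with hlast
  · simp [hlast, Nat.lt_succ_iff.1 (hT.cornerTime_lt _), hF]
  · simp only [Nat.lt_succ_iff]

theorem tourSum_σ_firstCorner (hF : ∑ b, F b = 0) (a : Fin (n + 1)) :
    T.tourSum F (T.σ (T.firstCorner a)) = ∑ b ∈ Iic a, F b := by
  rw [hT.tourSum_σ hF]
  refine sum_congr ?_ fun _ _ => rfl
  ext b
  simp [hT.strictMono_cornerTime_firstCorner.le_iff_le]

theorem tourSum_σ_sub_tourSum_α_firstCorner (hF : ∑ b, F b = 0) (a : Fin (n + 1)) :
    T.tourSum F (T.σ (T.firstCorner a)) - T.tourSum F (T.α (T.firstCorner a)) = F a := by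
  rw [hT.tourSum_σ_firstCorner hF, hT.tourSum_α_firstCorner, ← sum_Iio_add_eq_sum_Iic,
    add_sub_cancel_left]

theorem eq_zero_of_tourSum_add_const_eq_zero (hF : ∑ b, F b = 0) {c : ℚ}
    (h : ∀ x, T.tourSum F x + c = 0) : F = 0 ∧ c = 0 := by
  have hF0 : F = 0 := funext fun a => by
    rw [← hT.tourSum_σ_sub_tourSum_α_firstCorner hF, eq_neg_of_add_eq_zero_left (h _),
      eq_neg_of_add_eq_zero_left (h _), sub_self, Pi.zero_apply]
  refine ⟨hF0, ?_⟩
  simpa [hF0] using h T.root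

theorem tourSum_σ_of_notMem_range (hF : ∑ b, F b = 0) {x : Fin (2 * n + 1)}
    (hx : x ∉ Set.range T.firstCorner) : T.tourSum F (T.σ x) = T.tourSum F (T.α x) := by
  rw [hT.tourSum_σ hF, tourSum_apply, T.α_α]
  refine sum_congr ?_ fun _ _ => rfl
  ext b
  have hne : T.cornerTime (T.firstCorner b) ≠ T.cornerTime x := fun h =>
    hx ⟨b, hT.cornerTime_injective h⟩
  simp [hne.le_iff_lt]

end IsTree

end RotationSystem

theorem exists_perm_periodicOrbit {X : Type*} [Finite X] {f : X → X} {x : X}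
    (hx : x ∈ Function.periodicPts f) :
    ∃ e : Equiv.Perm {y // y ∈ Function.periodicOrbit f x}, ∀ y, f (e y) = y := by
  have hmem (k) : f^[k] x ∈ Function.periodicOrbit f x := Function.iterate_mem_periodicOrbit hx k
  let φ (y : {y // y ∈ Function.periodicOrbit f x}) : {y // y ∈ Function.periodicOrbit f x} :=
    ⟨f y, by
      obtain ⟨k, hk⟩ := (Function.mem_periodicOrbit_iff hx).1 y.2
      rw [← hk, ← Function.iterate_succ_apply' f]
      exact hmem _⟩
  have hφ : Function.Surjective φ := by
    rintro ⟨y, hy⟩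
    obtain ⟨k, rfl⟩ := (Function.mem_periodicOrbit_iff hx).1 hy
    obtain ⟨m, hm, hper⟩ := hx
    refine ⟨⟨f^[k + m - 1] x, hmem _⟩, Subtype.ext ?_⟩
    calc f (f^[k + m - 1] x) = f^[k + m - 1 + 1] x := (Function.iterate_succ_apply' f _ x).symm
      _ = f^[k] (f^[m] x) := by
        rw [Nat.sub_add_cancel (by omega), Function.iterate_add_apply]
      _ = f^[k] x := by rw [hper.eq]
  let e := Equiv.ofBijective φ (Finite.surjective_iff_bijective.1 hφ)
  exact ⟨e.symm, fun y => congrArg Subtype.val (e.apply_symm_apply y)⟩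

theorem exists_simple_closed_walk {ι V : Type*} {src tgt : ι → V} {i : ι}
    (hex : ∃ (k : ℕ) (a : ℕ → ι), a 0 = i ∧ a (k + 1) = i ∧
      ∀ j ≤ k, tgt (a j) = src (a (j + 1))) :
    ∃ (k : ℕ) (a : ℕ → ι), a 0 = i ∧ a (k + 1) = i ∧ (∀ j ≤ k, tgt (a j) = src (a (j + 1))) ∧
      ∀ j l, j < l → l ≤ k → tgt (a j) ≠ tgt (a l) := by
  classical
  obtain ⟨a, hstart, hend, ha⟩ := Nat.find_spec hex
  have hmin (m) := Nat.find_min hex (m := m)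
  generalize Nat.find hex = k at *
  refine ⟨k, a, hstart, hend, ha, fun j l hjl hlk heq => ?_⟩
  let b (m : ℕ) : ι := if m ≤ j then a m else a (m + (l - j))
  have hle {m} (hm : m ≤ j) : b m = a m := if_pos hm
  have hgt {m} (hm : j < m) : b m = a (m + (l - j)) := if_neg (by omega)
  refine hmin (k - (l - j)) (by omega) ⟨b, by rw [hle (Nat.zero_le j), hstart], ?_, fun m hm => ?_⟩
  · rw [hgt (by omega), show k - (l - j) + 1 + (l - j) = k + 1 by omega, hend]
  · rcases lt_trichotomy m j with hmj | rfl | hjm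
    · rw [hle hmj.le, hle hmj]
      exact ha m (by omega)
    · rw [hle le_rfl, hgt (Nat.lt_succ_self m), heq, ha l hlk,
        show m + 1 + (l - m) = l + 1 by omega]
    · rw [hgt hjm, hgt (by omega), Nat.add_right_comm]
      exact ha _ (by omega)

namespace OrientedSystem

variable {n : ℕ} {M : OrientedSystem n} {x : Fin (2 * n + 1)}

section FirstHead

theorem firstHead_eq_of_forall {k : ℕ} (hk : M.isHead ((M.σ ^ k) x))
    (hlt : ∀ j < k, ¬ M.isHead ((M.σ ^ j) x)) : M.firstHead x = (M.σ ^ k) x := by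
  have hsInf : sInf {k : ℕ | M.isHead ((M.σ ^ k) x)} = k :=
    IsLeast.csInf_eq ⟨hk, fun j hj => le_of_not_gt fun h => hlt j h hj⟩
  rw [firstHead, hsInf]

theorem firstHead_of_isHead (hx : M.isHead x) : M.firstHead x = x :=
  firstHead_eq_of_forall (k := 0) hx fun j hj => absurd hj (Nat.not_lt_zero j)

theorem firstHead_explode_σ (M : OrientedSystem n) (x : Fin (2 * n + 1)) :
    M.firstHead (M.explode.σ x) = M.firstHead x :=
  (rel_inducedPerm M.σ (Setoid.ker M.firstHead) x).symm

/-- Every vertex is incident to a head; otherwise `firstHead` takes junk values. -/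
def HasHeads (M : OrientedSystem n) : Prop :=
  ∀ x, ∃ h, M.isHead h ∧ M.vertex h = M.vertex x

namespace HasHeads

variable (hM : M.HasHeads)
include hM

theorem exists_pow (x : Fin (2 * n + 1)) : ∃ k : ℕ, M.isHead ((M.σ ^ k) x) := by
  obtain ⟨h, hh, hv⟩ := hM x
  obtain ⟨k, rfl⟩ := (M.vertex_eq_iff.1 hv.symm).exists_nat_pow_eq
  exact ⟨k, hh⟩

theorem isHead_firstHead (x : Fin (2 * n + 1)) : M.isHead (M.firstHead x) :=
  Nat.sInf_mem (hM.exists_pow x)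

theorem firstHead_σ (hx : ¬ M.isHead x) : M.firstHead (M.σ x) = M.firstHead x := by
  classical
  have hpow (j : ℕ) : (M.σ ^ j) (M.σ x) = (M.σ ^ (j + 1)) x := by
    rw [pow_succ, Equiv.Perm.mul_apply]
  have hex := hM.exists_pow (M.σ x)
  have hspec := Nat.find_spec hex
  rw [firstHead_eq_of_forall hspec fun j hj => Nat.find_min hex hj, hpow,
    firstHead_eq_of_forall (hpow _ ▸ hspec) fun j hj => ?_]
  rcases j with _ | j
  · exact hx
  · rw [← hpow]
    exact Nat.find_min hex (by omega)

theorem explode_σ_of_not_isHead (hx : ¬ M.isHead x) : M.explode.σ x = M.σ x :=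
  inducedPerm_eq_of_rel (hM.firstHead_σ hx).symm

theorem firstHead_induction {Q : Fin (2 * n + 1) → Prop} (head : ∀ x, M.isHead x → Q x)
    (tail : ∀ x, ¬ M.isHead x → Q (M.σ x) → Q x) (x : Fin (2 * n + 1)) : Q x := by
  obtain ⟨k, hk⟩ := hM.exists_pow x
  induction k generalizing x with
  | zero => exact head x hk
  | succ k ih =>
    by_cases hx : M.isHead x
    · exact head x hx
    · exact tail x hx (ih (M.σ x) (by rwa [← Equiv.Perm.mul_apply, ← pow_succ]))

theorem explode_vertex_firstHead (x : Fin (2 * n + 1)) :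
    M.explode.vertex (M.firstHead x) = M.explode.vertex x := by
  refine hM.firstHead_induction
    (Q := fun x => M.explode.vertex (M.firstHead x) = M.explode.vertex x)
    (fun x hx => by rw [firstHead_of_isHead hx]) (fun x hx ih => ?_) x
  rwa [hM.firstHead_σ hx, ← hM.explode_σ_of_not_isHead hx, M.explode.vertex_σ] at ih

theorem explode_vertex_eq_iff {x y : Fin (2 * n + 1)} :
    M.explode.vertex x = M.explode.vertex y ↔ M.firstHead x = M.firstHead y :=
  ⟨fun h => apply_eq_of_sameCycle M.firstHead_explode_σ (M.explode.vertex_eq_iff.1 h), fun h => by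
    rw [← hM.explode_vertex_firstHead x, h, hM.explode_vertex_firstHead]⟩

end HasHeads

theorem vertex_eq_of_explode_vertex_eq {x y : Fin (2 * n + 1)}
    (h : M.explode.vertex x = M.explode.vertex y) : M.vertex x = M.vertex y :=
  M.vertex_eq_iff.2 (sameCycle_inducedPerm_iff.1 (M.explode.vertex_eq_iff.1 h)).1

theorem HasHeads.vertex_firstHead (hM : M.HasHeads) (x : Fin (2 * n + 1)) :
    M.vertex (M.firstHead x) = M.vertex x :=
  vertex_eq_of_explode_vertex_eq (hM.explode_vertex_firstHead x)

end FirstHead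

section Parent

/-- For a head `h`, the head of the exploded vertex from which the edge of `h` comes. The root is
its own parent. -/
noncomputable def parent (M : OrientedSystem n) (h : Fin (2 * n + 1)) : Fin (2 * n + 1) :=
  M.firstHead (M.α h)

theorem IsOriented.parent_root (hM : M.IsOriented) : M.parent M.root = M.root := by
  rw [parent, M.α_root, firstHead_of_isHead hM.root_isHead]

variable {Y : Type*} [Preorder Y] {w : Fin (2 * n + 1) → Y}

theorem HasHeads.le_firstHead (hM : M.HasHeads) (hw : M.IsFaceFun w)
    (hup : ∀ t, ¬ M.isHead t → w t ≤ w (M.α t)) (x : Fin (2 * n + 1)) :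
    w x ≤ w (M.firstHead x) := by
  refine hM.firstHead_induction (Q := fun x => w x ≤ w (M.firstHead x))
    (fun x hx => by rw [firstHead_of_isHead hx]) (fun x hx ih => ?_) x
  rw [hw, hM.firstHead_σ hx] at ih
  exact (hup x hx).trans ih

theorem HasHeads.le_parent (hM : M.HasHeads) (hO : M.IsOriented) (hw : M.IsFaceFun w)
    (hup : ∀ t, ¬ M.isHead t → w t ≤ w (M.α t)) {h : Fin (2 * n + 1)} (hh : M.isHead h) :
    w h ≤ w (M.parent h) := by
  by_cases hr : h = M.root
  · rw [hr, hO.parent_root]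
  · have := hM.le_firstHead hw hup (M.σ (M.α h))
    rwa [hw, M.α_α, hM.firstHead_σ (hO.not_isHead_α hr hh)] at this

end Parent

section DirectedCycle

variable {ι : Type*} {c : ι → Fin (2 * n + 1)}

theorem exists_isFaceFun_of_closed [Finite ι] (hM : M.IsMap) (hO : M.IsOriented)
    (htail : ∀ i, ¬ M.isHead (c i)) (hinj : Function.Injective c) (e : Equiv.Perm ι)
    (he : ∀ i, M.vertex (M.α (c i)) = M.vertex (c (e i))) :
    ∃ w : Fin (2 * n + 1) → ℚ, M.IsFaceFun w ∧ (∀ t, ¬ M.isHead t → w t ≤ w (M.α t)) ∧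
      (∀ i, w (M.α (c i)) = w (c i) + 1) ∧
      ∀ x, x ∉ Set.range c → M.α x ∉ Set.range c → w (M.α x) = w x := by
  have := Fintype.ofFinite ι
  have hα {t} (ht : ¬ M.isHead t) (i) : c i ≠ M.α t := fun h =>
    htail i (h ▸ hO.isHead_α_of_not_isHead ht)
  obtain ⟨w, hw, hjump⟩ := hM.exists_isFaceFun_jump_eq (RotationSystem.isCirculation_flow e he)
  refine ⟨w, hw, fun t ht => ?_, fun i => ?_, fun x hx hαx => ?_⟩
  · rw [← sub_nonneg, hjump]
    exact RotationSystem.flow_nonneg (hα ht)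
  · rw [← sub_eq_iff_eq_add', hjump]
    exact RotationSystem.flow_apply_self hinj (fun i j => hα (htail j) i) i
  · rw [← sub_eq_zero, hjump]
    exact RotationSystem.flow_eq_zero hx hαx

theorem exists_isDirectedCycle [Finite ι] (htail : ∀ i, ¬ M.isHead (c i)) (e : Equiv.Perm ι)
    (he : ∀ i, M.vertex (M.α (c i)) = M.vertex (c (e i))) (i : ι) :
    ∃ (k : ℕ) (d : Fin (k + 1) → ι), d 0 = i ∧ M.IsDirectedCycle (c ∘ d) := by
  obtain ⟨N, hN, hper⟩ := e.injective.mem_periodicPts i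
  obtain ⟨k, a, hstart, hend, ha, hsimple⟩ := exists_simple_closed_walk (i := i)
    (src := fun i => M.vertex (c i)) (tgt := fun i => M.vertex (M.α (c i)))
    ⟨N - 1, fun j => e^[j] i, rfl, by rwa [Nat.sub_add_cancel hN], fun j _ => by
      rw [he, ← Function.iterate_succ_apply' e]⟩
  let d (j : Fin (k + 1)) : ι := a j
  have hnext (j) : M.vertex (M.α (c (d j))) = M.vertex (c (d (j + 1))) := by
    rw [ha j (Nat.le_of_lt_succ j.2)]
    refine congrArg (fun i => M.vertex (c i)) ?_
    rcases eq_or_ne j (Fin.last k) with rfl | hj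
    · rw [Fin.val_last, hend, Fin.last_add_one]
      exact hstart.symm
    · rw [← Fin.val_add_one_of_lt (Fin.lt_last_iff_ne_last.2 hj)]
  have hinj : Function.Injective fun j => M.vertex (M.α (c (d j))) :=
    .of_lt_imp_ne fun j l hjl => hsimple j l hjl (Nat.le_of_lt_succ l.2)
  refine ⟨k, d, hstart, fun j => htail _, hnext, fun j l hjl => ?_⟩
  refine sub_left_injective (b := 1) (hinj ?_)
  simpa only [hnext, sub_add_cancel, Function.comp_apply] using hjl

theorem avoidStep_iff_faceStep {k : ℕ} {c : Fin (k + 1) → Fin (2 * n + 1)}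
    {x y : Fin (2 * n + 1)} : M.AvoidStep c x y ↔ M.FaceStep (Set.range c) x y := by
  simp only [AvoidStep, RotationSystem.FaceStep, Set.mem_range, not_exists, forall_and, ne_eq,
    eq_comm (a := x), M.α_eq_iff]

end DirectedCycle

section OfArborescence

variable (hA : M.explode.IsArborescence M.isHead)
include hA

theorem isOriented_of_isArborescence_explode : M.IsOriented :=
  ⟨hA.isOriented.root_isHead, hA.isOriented.isHead_α⟩

theorem hasHeads_of_isArborescence_explode : M.HasHeads := fun x =>
  let ⟨h, ⟨hh, hv⟩, _⟩ := hA.existsUnique_head (M.explode.vertex x)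
  ⟨h, hh, vertex_eq_of_explode_vertex_eq hv⟩

theorem reachable_of_isArborescence_explode (v : M.Vertex) :
    Relation.ReflTransGen M.Arc (M.vertex M.root) v := by
  have hH := hasHeads_of_isArborescence_explode hA
  have hO := isOriented_of_isArborescence_explode hA
  obtain ⟨x, rfl⟩ := M.vertex_surjective v
  obtain ⟨h, hh, hv⟩ := hH x
  rw [← hv]
  refine hA.head_induction
    (Q := fun h => Relation.ReflTransGen M.Arc (M.vertex M.root) (M.vertex h)) .refl
    (fun h g hh _ hαh hg => ?_) h hh
  by_cases hr : h = M.root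
  · exact hr ▸ .refl
  · exact hg.tail ⟨M.α h, hO.not_isHead_α hr hh, vertex_eq_of_explode_vertex_eq hαh,
      by rw [M.α_α]⟩

theorem not_rootInExterior_of_isArborescence_explode (hM : M.IsMap) {k : ℕ}
    {c : Fin (k + 1) → Fin (2 * n + 1)} (hc : M.IsDirectedCycle c) : ¬ M.RootInExterior c := by
  have hH := hasHeads_of_isArborescence_explode hA
  have hO := isOriented_of_isArborescence_explode hA
  rintro ⟨i, hi⟩
  obtain ⟨w, hw, hup, hcross, hoff⟩ := exists_isFaceFun_of_closed hM hO hc.tail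
    (fun i j hij => hc.simple (congrArg M.vertex hij)) (Equiv.addRight 1) hc.consecutive
  have hhead (h) (hh : M.isHead h) : w h ≤ w M.root := by
    refine hA.head_induction (Q := fun h => w h ≤ w M.root) le_rfl (fun h g hh hg hαh ih => ?_) h hh
    refine (hH.le_parent hO hw hup hh).trans ?_
    have hparent : M.parent h = g :=
      (hH.explode_vertex_eq_iff.1 hαh).trans (firstHead_of_isHead hg)
    rwa [hparent]
  have hroot : w (c i) = w M.root :=
    hw.apply_eq_of_eqvGen hoff (hi.mono fun _ _ => avoidStep_iff_faceStep.1)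
  have := hhead _ (hO.isHead_α_of_not_isHead (hc.tail i))
  linarith [hcross i]

theorem isTreeOriented_of_isArborescence_explode (hM : M.IsMap) : M.IsTreeOriented :=
  ⟨hM, isOriented_of_isArborescence_explode hA, reachable_of_isArborescence_explode hA,
    fun _ _ hc => not_rootInExterior_of_isArborescence_explode hA hM hc⟩

end OfArborescence

end OrientedSystem

namespace OrientedSystem

variable {n : ℕ} {M : OrientedSystem n} {x g h : Fin (2 * n + 1)}

/-- When `h` is a periodic point of `parent`, its orbit: the heads of the edges of a directed
cycle of the exploded map. -/
def parentCycle (M : OrientedSystem n) (h : Fin (2 * n + 1)) : Set (Fin (2 * n + 1)) :=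
  {g | g ∈ Function.periodicOrbit M.parent h}

theorem HasHeads.vertex_α_α_eq (hH : M.HasHeads) {e : Equiv.Perm (M.parentCycle h)}
    (he : ∀ g, M.parent (e g) = g) (g : M.parentCycle h) :
    M.vertex (M.α (M.α g)) = M.vertex (M.α (e g)) := by
  rw [M.α_α, ← hH.vertex_firstHead (M.α (e g)), ← parent, he]

section ParentCycle

variable (hh : h ∈ Function.periodicPts M.parent)
include hh

theorem mem_parentCycle_iff : g ∈ M.parentCycle h ↔ ∃ k, M.parent^[k] h = g :=
  Function.mem_periodicOrbit_iff hh

theorem self_mem_parentCycle : h ∈ M.parentCycle h :=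
  Function.self_mem_periodicOrbit hh

theorem iterate_parent_mem_parentCycle (hg : g ∈ M.parentCycle h) (k : ℕ) :
    M.parent^[k] g ∈ M.parentCycle h := by
  obtain ⟨l, rfl⟩ := (mem_parentCycle_iff hh).1 hg
  rw [← Function.iterate_add_apply]
  exact Function.iterate_mem_periodicOrbit hh _

theorem exists_iterate_parent_eq (hg : g ∈ M.parentCycle h) : ∃ k, M.parent^[k] g = h := by
  obtain ⟨k, rfl⟩ := (mem_parentCycle_iff hh).1 hg
  have hk : M.parent^[k] h ∈ Function.periodicPts M.parent :=
    let ⟨m, hm, hper⟩ := hh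
    ⟨m, hm, hper.apply_iterate k⟩
  refine (mem_parentCycle_iff hk).1 ?_
  rw [parentCycle, Function.periodicOrbit_apply_iterate_eq hh]
  exact self_mem_parentCycle hh

theorem exists_perm_parentCycle :
    ∃ e : Equiv.Perm (M.parentCycle h), ∀ g, M.parent (e g) = g :=
  exists_perm_periodicOrbit hh

theorem isHead_of_mem_parentCycle (hH : M.HasHeads) (hg : g ∈ M.parentCycle h) : M.isHead g := by
  obtain ⟨e, he⟩ := exists_perm_parentCycle hh
  have hparent : M.parent (e ⟨g, hg⟩) = g := he ⟨g, hg⟩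
  exact hparent ▸ hH.isHead_firstHead _

theorem ne_root_of_mem_parentCycle (hO : M.IsOriented) (hr : h ≠ M.root)
    (hg : g ∈ M.parentCycle h) : g ≠ M.root := by
  rintro rfl
  obtain ⟨k, hk⟩ := exists_iterate_parent_eq hh hg
  exact hr (by rw [← hk, Function.iterate_fixed hO.parent_root])

theorem not_isHead_α_of_mem_parentCycle (hH : M.HasHeads) (hO : M.IsOriented) (hr : h ≠ M.root)
    (hg : g ∈ M.parentCycle h) : ¬ M.isHead (M.α g) :=
  hO.not_isHead_α (ne_root_of_mem_parentCycle hh hO hr hg) (isHead_of_mem_parentCycle hh hH hg)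

theorem apply_eq_of_mem_parentCycle {Y : Type*} [PartialOrder Y] {w : Fin (2 * n + 1) → Y}
    (hw : ∀ g ∈ M.parentCycle h, w g ≤ w (M.parent g)) (hg : g ∈ M.parentCycle h) :
    w g = w h := by
  have hiter (k) {g} (hg : g ∈ M.parentCycle h) : w g ≤ w (M.parent^[k] g) := by
    induction k with
    | zero => exact le_rfl
    | succ k ih =>
      rw [Function.iterate_succ_apply']
      exact ih.trans (hw _ (iterate_parent_mem_parentCycle hh hg k))
  obtain ⟨k, hk⟩ := exists_iterate_parent_eq hh hg
  obtain ⟨l, hl⟩ := (mem_parentCycle_iff hh).1 hg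
  exact le_antisymm (hk ▸ hiter k hg) (hl ▸ hiter l (self_mem_parentCycle hh))

end ParentCycle

section IsTreeOriented

theorem hasHeads_of_reachable (hO : M.IsOriented)
    (hM : ∀ v, Relation.ReflTransGen M.Arc (M.vertex M.root) v) : M.HasHeads :=
  reachable_induction hM ⟨M.root, hO.root_isHead, rfl⟩
    (fun x ⟨h, hh, hv⟩ => ⟨h, hh, hv.trans (M.vertex_σ x)⟩)
    fun t ht _ => ⟨M.α t, hO.isHead_α_of_not_isHead ht, rfl⟩

theorem exists_isFaceFun_parentCycle (hM : M.IsMap) (hO : M.IsOriented) (hH : M.HasHeads)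
    (hh : h ∈ Function.periodicPts M.parent) (hr : h ≠ M.root) :
    ∃ (w : Fin (2 * n + 1) → ℚ) (b : ℚ), M.IsFaceFun w ∧
      (∀ g ∈ M.parentCycle h, w g = b ∧ w (M.α g) ≠ b) ∧
      ∀ x, x ∉ M.parentCycle h → M.α x ∉ M.parentCycle h → w (M.α x) = w x := by
  obtain ⟨e, he⟩ := exists_perm_parentCycle hh
  obtain ⟨w, hw, hup, hcross, hoff⟩ := exists_isFaceFun_of_closed hM hO
    (c := fun g : M.parentCycle h => M.α g)
    (fun g => not_isHead_α_of_mem_parentCycle hh hH hO hr g.2)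
    (fun f g hfg => Subtype.ext (M.α.injective hfg)) e
    (hH.vertex_α_α_eq he)
  have hconst {g} (hg : g ∈ M.parentCycle h) : w g = w h :=
    apply_eq_of_mem_parentCycle hh
      (fun g hg => hH.le_parent hO hw hup (isHead_of_mem_parentCycle hh hH hg)) hg
  have hrange {x} (hx : M.α x ∉ M.parentCycle h) :
      x ∉ Set.range fun g : M.parentCycle h => M.α g := by
    rintro ⟨g, rfl⟩
    rw [M.α_α] at hx
    exact hx g.2
  refine ⟨w, w h, hw, fun g hg => ⟨hconst hg, fun hα => ?_⟩, fun x hx hαx =>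
    hoff x (hrange hαx) (hrange (by rwa [M.α_α]))⟩
  have := hcross ⟨g, hg⟩
  rw [M.α_α, hα, hconst hg] at this
  linarith

theorem apply_root_ne (hO : M.IsOriented)
    (hM : ∀ v, Relation.ReflTransGen M.Arc (M.vertex M.root) v)
    (hh : h ∈ Function.periodicPts M.parent) (hr : h ≠ M.root) {Y : Type*}
    {w : Fin (2 * n + 1) → Y} {b : Y} (hw : M.IsFaceFun w)
    (hb : ∀ g ∈ M.parentCycle h, w g = b ∧ w (M.α g) ≠ b)
    (hoff : ∀ x, x ∉ M.parentCycle h → M.α x ∉ M.parentCycle h → w (M.α x) = w x) :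
    w M.root ≠ b := by
  -- A head enters the cycle only from the side where `w ≠ b`, so with `w M.root = b` a directed
  -- path from the root would never reach the cycle.
  intro hroot
  have hH := hasHeads_of_reachable hO hM
  have hhead {g} (hg : g ∈ M.parentCycle h) : M.isHead g := isHead_of_mem_parentCycle hh hH hg
  have htail {t} (ht : M.α t ∈ M.parentCycle h) : M.firstHead t ∈ M.parentCycle h := by
    have := iterate_parent_mem_parentCycle hh ht 1
    rwa [Function.iterate_one, parent, M.α_α] at this
  have hgood : ∀ x, w x = b ∧ M.firstHead x ∉ M.parentCycle h := by
    refine reachable_induction hM ⟨hroot, ?_⟩ ?_ ?_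
    · rw [firstHead_of_isHead hO.root_isHead]
      exact fun hg => ne_root_of_mem_parentCycle hh hO hr hg rfl
    · rintro x ⟨hx, hfx⟩
      rw [hw] at hx
      by_cases hxh : M.isHead x
      · have hxP : x ∉ M.parentCycle h := fun hxP => (hb x hxP).2 hx
        have hαx : M.α x ∉ M.parentCycle h := fun hαx =>
          not_isHead_α_of_mem_parentCycle hh hH hO hr hαx (by rwa [M.α_α])
        rw [firstHead_of_isHead hxh, ← hoff x hxP hαx]
        exact ⟨hx, hxP⟩
      · rw [hH.firstHead_σ hxh] at hfx
        rw [← hoff x (fun hxP => hxh (hhead hxP)) fun hαx => hfx (htail hαx)]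
        exact ⟨hx, hfx⟩
    · rintro t ht ⟨htb, hft⟩
      have hαt : M.α t ∉ M.parentCycle h := fun hαt => hft (htail hαt)
      rw [hoff t (fun htP => ht (hhead htP)) hαt,
        firstHead_of_isHead (hO.isHead_α_of_not_isHead ht)]
      exact ⟨htb, hαt⟩
  have hself := self_mem_parentCycle hh
  refine (hgood h).2 ?_
  rwa [firstHead_of_isHead (hhead hself)]

namespace IsTreeOriented

variable (hM : M.IsTreeOriented)
include hM

theorem hasHeads : M.HasHeads := hasHeads_of_reachable hM.isOriented hM.reachable

theorem eq_root_of_mem_periodicPts (hh : h ∈ Function.periodicPts M.parent) : h = M.root := by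
  by_contra hr
  have hO := hM.isOriented
  have hH := hM.hasHeads
  obtain ⟨w, b, hw, hb, hoff⟩ := exists_isFaceFun_parentCycle hM.isMap hO hH hh hr
  obtain ⟨x, hx, hxP⟩ := RotationSystem.IsConnected.exists_eqvGen_root hM.isMap.connected
    (S := M.parentCycle h) ⟨h, self_mem_parentCycle hh⟩
  rcases hxP with hxP | hxP
  · refine apply_root_ne hO hM.reachable hh hr hw hb hoff ?_
    rw [← hw.apply_eq_of_eqvGen hoff hx, (hb x hxP).1]
  · obtain ⟨e, he⟩ := exists_perm_parentCycle hh
    obtain ⟨k, d, hd, hcycle⟩ := exists_isDirectedCycle (c := fun g : M.parentCycle h => M.α g)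
      (fun g => not_isHead_α_of_mem_parentCycle hh hH hO hr g.2) e
      (hH.vertex_α_α_eq he) ⟨_, hxP⟩
    refine hM.no_positive_cycle k _ hcycle ⟨0, ?_⟩
    rw [Function.comp_apply, hd, M.α_α]
    refine hx.mono fun y z hyz => avoidStep_iff_faceStep.2 (hyz.imp_right ?_)
    rintro ⟨rfl, hy, hαy⟩
    refine ⟨rfl, ?_, ?_⟩
    · rintro ⟨i, rfl⟩
      exact hαy (by rw [Function.comp_apply, M.α_α]; exact (d i).2)
    · rintro ⟨i, hi⟩
      exact hy (M.α.injective hi ▸ (d i).2)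

theorem exists_iterate_parent_eq_root (h : Fin (2 * n + 1)) : ∃ k, M.parent^[k] h = M.root := by
  obtain ⟨i, j, hij, heq⟩ := Set.finite_univ.exists_lt_map_eq_of_forall_mem
    (f := fun k => M.parent^[k] h) fun _ => Set.mem_univ _
  refine ⟨i, hM.eq_root_of_mem_periodicPts ⟨j - i, by omega, ?_⟩⟩
  rw [Function.IsPeriodicPt, Function.IsFixedPt, ← Function.iterate_add_apply,
    Nat.sub_add_cancel hij.le]
  exact heq.symm

theorem isArborescence_explode : M.explode.IsArborescence M.isHead := by
  have hO := hM.isOriented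
  have hH := hM.hasHeads
  have hvertex (x) := hH.explode_vertex_firstHead x
  have hreach (k : ℕ) {g} (hg : M.isHead g) (hk : M.parent^[k] g = M.root) :
      Relation.ReflTransGen (OrientedSystem.mk M.explode M.isHead).Arc
        (M.explode.vertex M.explode.root) (M.explode.vertex g) := by
    induction k generalizing g with
    | zero => exact hk ▸ .refl
    | succ k ih =>
      by_cases hr : g = M.root
      · exact hr ▸ .refl
      · exact (ih (hH.isHead_firstHead _) hk).tail ⟨M.α g, hO.not_isHead_α hr hg,
          (hvertex _).symm, congrArg M.explode.vertex (M.α_α g)⟩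
  refine ⟨⟨hO.root_isHead, hO.isHead_α⟩, M.explode.vertex_surjective.forall.2 fun x =>
    ⟨M.firstHead x, ⟨hH.isHead_firstHead x, hvertex x⟩, fun g hg => ?_⟩,
    M.explode.vertex_surjective.forall.2 fun x => ?_⟩
  · rw [← hH.explode_vertex_eq_iff.1 hg.2, firstHead_of_isHead hg.1]
  · obtain ⟨k, hk⟩ := hM.exists_iterate_parent_eq_root (M.firstHead x)
    rw [← hvertex x]
    exact hreach k (hH.isHead_firstHead x) hk

theorem isTree_explode : M.explode.IsTree := hM.isArborescence_explode.isTree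

end IsTreeOriented

end IsTreeOriented

end OrientedSystem

namespace RotationSystem

variable {n : ℕ} {T : RotationSystem n} {F : Fin (n + 1) → ℚ}

namespace IsTree

variable (hT : T.IsTree)

/-- The rank of the vertex incident to a half-edge of a tree, in the order of appearance. -/
noncomputable def rank (x : Fin (2 * n + 1)) : Fin (n + 1) :=
  (Equiv.ofBijective _ hT.nthVertex_bijective).symm (T.vertex x)

theorem rank_σ (x : Fin (2 * n + 1)) : hT.rank (T.σ x) = hT.rank x := by
  rw [rank, rank, T.vertex_σ]

theorem rank_firstCorner (i : Fin (n + 1)) : hT.rank (T.firstCorner i) = i :=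
  (Equiv.ofBijective _ hT.nthVertex_bijective).symm_apply_apply i

theorem vertex_firstCorner_rank (x : Fin (2 * n + 1)) :
    T.vertex (T.firstCorner (hT.rank x)) = T.vertex x :=
  (Equiv.ofBijective _ hT.nthVertex_bijective).apply_symm_apply (T.vertex x)

end IsTree

section Glue

variable (hT : T.IsTree) (s : Setoid (Fin (n + 1))) {x y h : Fin (2 * n + 1)}

theorem glue_σ_firstCorner (i : Fin (n + 1)) : (T.glue hT s).σ (T.firstCorner i) =
    T.σ (T.firstCorner (inducedPerm (finRotate (n + 1))⁻¹ s i)) :=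
  congrArg T.σ (Equiv.Perm.viaEmbedding_apply _ ⟨T.firstCorner, hT.firstCorner_injective⟩ i)

theorem glue_σ_of_not_isHead (hx : ¬ (T.glue hT s).isHead x) : (T.glue hT s).σ x = T.σ x :=
  congrArg T.σ (Equiv.Perm.viaEmbedding_apply_of_notMem _ _ _ fun hmem =>
    hx ((hT.mem_range_firstCorner_iff hT.isArborescence).1 hmem))

theorem rank_glue_σ (x : Fin (2 * n + 1)) : s (hT.rank ((T.glue hT s).σ x)) (hT.rank x) := by
  by_cases hx : (T.glue hT s).isHead x
  · obtain ⟨i, rfl⟩ := (hT.mem_range_firstCorner_iff hT.isArborescence).2 hx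
    rw [glue_σ_firstCorner, hT.rank_σ, hT.rank_firstCorner, hT.rank_firstCorner]
    exact s.symm' (rel_inducedPerm _ s i)
  · rw [glue_σ_of_not_isHead hT s hx, hT.rank_σ]

theorem glue_vertex_eq_of_isHead (hh : (T.glue hT s).isHead h) (hx : T.vertex x = T.vertex h) :
    (T.glue hT s).vertex x = (T.glue hT s).vertex h :=
  (T.glue hT s).vertex_eq_iff.2 <| sameCycle_of_eq_off_transversal
    (fun _ => glue_σ_of_not_isHead hT s)
    (fun _ _ ha hb hab => hT.isArborescence.head_unique ha hb (T.vertex_eq_iff.2 hab)) hh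
    (T.vertex_eq_iff.1 hx)

theorem glue_vertex_firstCorner_rank (x : Fin (2 * n + 1)) :
    (T.glue hT s).vertex (T.firstCorner (hT.rank x)) = (T.glue hT s).vertex x :=
  (glue_vertex_eq_of_isHead hT s (hT.isHead_firstCorner hT.isArborescence _)
    (hT.vertex_firstCorner_rank x).symm).symm

theorem glue_vertex_eq_iff :
    (T.glue hT s).vertex x = (T.glue hT s).vertex y ↔ s (hT.rank x) (hT.rank y) := by
  refine ⟨fun h => Quotient.exact (apply_eq_of_sameCycle
    (f := fun x => Quotient.mk s (hT.rank x)) (fun x => Quotient.sound (rank_glue_σ hT s x))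
    ((T.glue hT s).vertex_eq_iff.1 h)), fun h => ?_⟩
  rw [← glue_vertex_firstCorner_rank, ← glue_vertex_firstCorner_rank hT s y]
  refine apply_eq_of_sameCycle (f := fun i => (T.glue hT s).vertex (T.firstCorner i)) (fun i => ?_)
    (sameCycle_inducedPerm_finRotate h)
  rw [← (T.glue hT s).vertex_σ (T.firstCorner i), glue_σ_firstCorner]
  exact (glue_vertex_eq_of_isHead hT s (hT.isHead_firstCorner hT.isArborescence _)
    (T.vertex_σ _)).symm

theorem hasHeads_glue : (T.glue hT s).HasHeads := fun x =>
  ⟨_, hT.isHead_firstCorner hT.isArborescence _, glue_vertex_firstCorner_rank hT s x⟩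

theorem firstHead_glue (x : Fin (2 * n + 1)) :
    (T.glue hT s).firstHead x = T.firstCorner (hT.rank x) := by
  refine (hasHeads_glue hT s).firstHead_induction
    (Q := fun x => (T.glue hT s).firstHead x = T.firstCorner (hT.rank x))
    (fun x hx => ?_) (fun x hx ih => ?_) x
  · rw [OrientedSystem.firstHead_of_isHead hx]
    exact hT.isArborescence.head_unique hx (hT.isHead_firstCorner hT.isArborescence _)
      (hT.vertex_firstCorner_rank x).symm
  · rwa [(hasHeads_glue hT s).firstHead_σ hx, glue_σ_of_not_isHead hT s hx, hT.rank_σ] at ih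

theorem explode_glue_σ : (T.glue hT s).explode.σ = T.σ := by
  refine perm_eq_of_eq_off_transversal (p := (T.glue hT s).isHead) (f := (T.glue hT s).firstHead)
    (fun x hx => ?_) (OrientedSystem.firstHead_explode_σ _) (fun x => ?_) (fun a b ha hb h => ?_)
  · rw [(hasHeads_glue hT s).explode_σ_of_not_isHead hx, glue_σ_of_not_isHead hT s hx]
  · rw [firstHead_glue, firstHead_glue, hT.rank_σ]
  · rwa [OrientedSystem.firstHead_of_isHead ha, OrientedSystem.firstHead_of_isHead hb] at h

theorem explode_glue : (T.glue hT s).explode = T :=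
  congrArg (fun σ => (⟨σ, T.α, T.root, T.α_α, T.α_eq_self_iff⟩ : RotationSystem n))
    (explode_glue_σ hT s)

theorem explosionPartition_glue : (T.glue hT s).explosionPartition = s := by
  ext i j
  rw [OrientedSystem.explosionPartition, Setoid.ker_def, explode_glue, glue_vertex_eq_iff,
    hT.rank_firstCorner, hT.rank_firstCorner]

theorem isArborescence_explode_glue :
    (T.glue hT s).explode.IsArborescence (T.glue hT s).isHead := by
  rw [explode_glue]
  exact hT.isArborescence

theorem isConnected_glue : (T.glue hT s).IsConnected :=
  OrientedSystem.isConnected_of_reachable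
    (OrientedSystem.reachable_of_isArborescence_explode (isArborescence_explode_glue hT s))

theorem card_quotient_le_card_vertex_glue :
    Nat.card (Quotient s) ≤ Nat.card (T.glue hT s).Vertex := by
  refine Nat.card_le_card_of_injective
    (Quotient.lift (fun i => (T.glue hT s).vertex (T.firstCorner i)) fun i j h => ?_)
    fun p q => Quotient.inductionOn₂ p q fun i j h => Quotient.sound ?_
  · rwa [glue_vertex_eq_iff, hT.rank_firstCorner, hT.rank_firstCorner]
  · rwa [Quotient.lift_mk, Quotient.lift_mk, glue_vertex_eq_iff, hT.rank_firstCorner,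
      hT.rank_firstCorner] at h

variable {s} (hs : IsNonCrossing s)
include hs

theorem isFaceFun_glue_tourSum (hF : blockSum s F = 0) :
    (T.glue hT s).IsFaceFun (T.tourSum F) := fun x => by
  have hsum := sum_eq_zero_of_blockSum_eq_zero hF (U := univ) fun _ _ _ _ => mem_univ _
  by_cases hx : x ∈ Set.range T.firstCorner
  · obtain ⟨i, rfl⟩ := hx
    rw [glue_σ_firstCorner, hT.tourSum_σ_firstCorner hsum,
      ← hs.sum_Iio_eq_sum_Iic hF (cyclicPred_inducedPerm s i)]
    exact (hT.tourSum_α_firstCorner F i).symm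
  · rw [glue_σ_of_not_isHead hT s fun h =>
      hx ((hT.mem_range_firstCorner_iff hT.isArborescence).2 h)]
    exact hT.tourSum_σ_of_notMem_range hsum hx

theorem finrank_ker_blockSum_add_one_le_card_face_glue :
    Module.finrank ℚ (LinearMap.ker (blockSum s)) + 1 ≤ Nat.card (T.glue hT s).Face := by
  have := Fintype.ofFinite (T.glue hT s).Face
  let Ψ : LinearMap.ker (blockSum s) × ℚ →ₗ[ℚ] (T.glue hT s).Face → ℚ :=
    LinearMap.funLeft ℚ ℚ Quotient.out ∘ₗ
      (T.tourSum ∘ₗ Submodule.subtype _).coprod (LinearMap.toSpanSingleton ℚ _ 1)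
  have hΨ : Function.Injective Ψ := (injective_iff_map_eq_zero Ψ).2 fun ⟨⟨F, hF⟩, c⟩ h => by
    have hsum := sum_eq_zero_of_blockSum_eq_zero hF (U := univ) fun _ _ _ _ => mem_univ _
    have hzero (x : Fin (2 * n + 1)) : T.tourSum F x + c = 0 := by
      rw [(isFaceFun_glue_tourSum hT hs hF).apply_eq
        (Quotient.out_eq ((T.glue hT s).face x)).symm]
      exact (congrArg _ (mul_one c).symm).trans (congrFun h ((T.glue hT s).face x))
    obtain ⟨rfl, rfl⟩ := hT.eq_zero_of_tourSum_add_const_eq_zero hsum hzero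
    rfl
  simpa [← Nat.card_eq_fintype_card] using LinearMap.finrank_le_finrank_of_injective hΨ

theorem isMap_glue : (T.glue hT s).IsMap := by
  refine ⟨isConnected_glue hT s,
    (isConnected_glue hT s).card_vertex_add_card_face_le.antisymm ?_⟩
  have hker := card_le_finrank_ker_blockSum_add s
  have hface := finrank_ker_blockSum_add_one_le_card_face_glue hT hs
  have hvertex := card_quotient_le_card_vertex_glue hT s
  rw [Fintype.card_fin] at hker
  omega

theorem isTreeOriented_glue : (T.glue hT s).IsTreeOriented :=
  OrientedSystem.isTreeOriented_of_isArborescence_explode (isArborescence_explode_glue hT s)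
    (isMap_glue hT hs)

end Glue

end RotationSystem

namespace OrientedSystem

variable {n : ℕ}

theorem vertex_explode_σ (M : OrientedSystem n) (x : Fin (2 * n + 1)) :
    M.vertex (M.explode.σ x) = M.vertex x :=
  vertex_eq_of_explode_vertex_eq (M.explode.vertex_σ x)

theorem explosionPartition_iff (M : OrientedSystem n) {i j : Fin (n + 1)} :
    M.explosionPartition i j ↔
      M.vertex (M.explode.firstCorner i) = M.vertex (M.explode.firstCorner j) :=
  Iff.rfl

theorem explosionPartition_of_explode_σ_eq {M : OrientedSystem n} {a b : Fin (n + 1)}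
    (hab : M.explode.σ (M.explode.firstCorner b) = M.σ (M.explode.firstCorner a)) :
    M.explosionPartition a b := by
  rw [explosionPartition_iff, ← M.vertex_σ, ← hab, M.vertex_explode_σ]

namespace IsTreeOriented

variable {M : OrientedSystem n} (hM : M.IsTreeOriented) {F : Fin (n + 1) → ℚ}
include hM

theorem isHead_explode_firstCorner (i : Fin (n + 1)) : M.isHead (M.explode.firstCorner i) :=
  hM.isTree_explode.isHead_firstCorner hM.isArborescence_explode i

theorem mem_range_explode_firstCorner_iff {x : Fin (2 * n + 1)} :
    x ∈ Set.range M.explode.firstCorner ↔ M.isHead x :=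
  hM.isTree_explode.mem_range_firstCorner_iff hM.isArborescence_explode

theorem explode_tourSum_explode_σ_of_not_isHead (hF : ∑ b, F b = 0) {x : Fin (2 * n + 1)}
    (hx : ¬ M.isHead x) :
    M.explode.tourSum F (M.explode.σ x) = M.explode.tourSum F (M.α x) :=
  hM.isTree_explode.tourSum_σ_of_notMem_range hF fun h =>
    hx (hM.mem_range_explode_firstCorner_iff.1 h)

theorem isCirculation_explode_tourSum_jump (hF : blockSum M.explosionPartition F = 0) :
    M.IsCirculation fun x => M.explode.tourSum F (M.α x) - M.explode.tourSum F x where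
  apply_α x := by rw [M.α_α, neg_sub]
  sum_mul_eq_zero u hu := by
    have hsum := sum_eq_zero_of_blockSum_eq_zero hF (U := univ) fun _ _ _ _ => mem_univ _
    set g := M.explode.tourSum F
    have htail {x} (hx : ¬ M.isHead x) : g (M.explode.σ x) = g (M.α x) :=
      hM.explode_tourSum_explode_σ_of_not_isHead hsum hx
    have hσ : ∑ x, u x * g (M.explode.σ x) = ∑ x, u x * g x := by
      rw [← Equiv.sum_comp M.explode.σ fun x => u x * g x]
      exact sum_congr rfl fun x _ => by rw [hu.apply_eq (M.vertex_explode_σ x)]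
    have hheads : ∑ x, u x * (g (M.explode.σ x) - g (M.α x)) = 0 :=
      calc ∑ x, u x * (g (M.explode.σ x) - g (M.α x))
          = ∑ a, u (M.explode.firstCorner a) * F a := by
            refine (Fintype.sum_of_injective M.explode.firstCorner
              hM.isTree_explode.firstCorner_injective _ _ (fun x hx => ?_) fun a => ?_).symm
            · rw [htail (mt hM.mem_range_explode_firstCorner_iff.2 hx), sub_self, mul_zero]
            · rw [← hM.isTree_explode.tourSum_σ_sub_tourSum_α_firstCorner hsum a]
              rfl
        _ = 0 := sum_mul_eq_zero_of_blockSum_eq_zero hF fun a b hab =>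
            hu.apply_eq (M.explosionPartition_iff.1 hab)
    simp only [mul_sub, sum_sub_distrib] at hheads ⊢
    linarith

theorem isFaceFun_explode_tourSum (hF : blockSum M.explosionPartition F = 0) :
    M.IsFaceFun (M.explode.tourSum F) := by
  have hsum := sum_eq_zero_of_blockSum_eq_zero hF (U := univ) fun _ _ _ _ => mem_univ _
  obtain ⟨w, hw, hjump⟩ :=
    hM.isMap.exists_isFaceFun_jump_eq (hM.isCirculation_explode_tourSum_jump hF)
  set g := M.explode.tourSum F
  have htail {x} (hx : ¬ M.isHead x) : g (M.explode.σ x) = g (M.α x) :=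
    hM.explode_tourSum_explode_σ_of_not_isHead hsum hx
  have hα (x) : w (M.α x) - g (M.α x) = w x - g x := by linarith [hjump x]
  have hfirst (x) : w x - g x = w (M.firstHead x) - g (M.firstHead x) := by
    refine hM.hasHeads.firstHead_induction
      (Q := fun x => w x - g x = w (M.firstHead x) - g (M.firstHead x))
      (fun x hx => by rw [firstHead_of_isHead hx]) (fun x hx ih => ?_) x
    rw [hM.hasHeads.firstHead_σ hx, hw, ← hM.hasHeads.explode_σ_of_not_isHead hx, htail hx] at ih
    rw [← ih, hα]
  have hconst (x) : w x - g x = w M.root - g M.root :=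
    RotationSystem.IsConnected.apply_eq_apply_root hM.isTree_explode.isMap.connected
      (u := fun x => w x - g x)
      (fun x => by beta_reduce; rw [hfirst, M.firstHead_explode_σ, ← hfirst]) hα x
  intro x
  linarith [hconst (M.σ x), hconst (M.α x), hw x]

theorem exists_explode_σ_firstCorner_eq (i : Fin (n + 1)) :
    ∃ j, M.explode.σ (M.explode.firstCorner j) = M.σ (M.explode.firstCorner i) := by
  obtain ⟨y, hy⟩ := M.explode.σ.surjective (M.σ (M.explode.firstCorner i))
  have hyd : M.isHead y := by
    by_contra hyd
    rw [hM.hasHeads.explode_σ_of_not_isHead hyd] at hy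
    exact hyd (M.σ.injective hy ▸ hM.isHead_explode_firstCorner i)
  obtain ⟨j, rfl⟩ := hM.mem_range_explode_firstCorner_iff.2 hyd
  exact ⟨j, hy⟩

variable {a b : Fin (n + 1)}

theorem sum_Iio_eq_sum_Iic_of_explode_σ_eq
    (hab : M.explode.σ (M.explode.firstCorner b) = M.σ (M.explode.firstCorner a))
    (hF : blockSum M.explosionPartition F = 0) : ∑ c ∈ Iio a, F c = ∑ c ∈ Iic b, F c := by
  have hT := hM.isTree_explode
  have hsum := sum_eq_zero_of_blockSum_eq_zero hF (U := univ) fun _ _ _ _ => mem_univ _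
  rw [← hT.tourSum_α_firstCorner, ← hT.tourSum_σ_firstCorner hsum, hab]
  exact (hM.isFaceFun_explode_tourSum hF _).symm

theorem isNonCrossing_explosionPartition : IsNonCrossing M.explosionPartition :=
  isNonCrossing_of_forall_exists_sum_Iio_eq_sum_Iic fun a =>
    let ⟨b, hab⟩ := hM.exists_explode_σ_firstCorner_eq a
    ⟨b, explosionPartition_of_explode_σ_eq hab, fun _ => hM.sum_Iio_eq_sum_Iic_of_explode_σ_eq hab⟩

theorem cyclicPred_of_explode_σ_eq
    (hab : M.explode.σ (M.explode.firstCorner b) = M.σ (M.explode.firstCorner a)) :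
    CyclicPred M.explosionPartition a b :=
  cyclicPred_of_sum_Iio_eq_sum_Iic (explosionPartition_of_explode_σ_eq hab) fun _ =>
    hM.sum_Iio_eq_sum_Iic_of_explode_σ_eq hab

theorem isHead_glue_explode :
    (M.explode.glue hM.isTree_explode M.explosionPartition).isHead = M.isHead :=
  hM.isTree_explode.isArborescence.unique hM.isArborescence_explode

theorem glue_explode_σ :
    (M.explode.glue hM.isTree_explode M.explosionPartition).σ = M.σ := by
  ext1 x
  by_cases hx : M.isHead x
  · obtain ⟨i, rfl⟩ := hM.mem_range_explode_firstCorner_iff.2 hx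
    obtain ⟨j, hj⟩ := hM.exists_explode_σ_firstCorner_eq i
    rw [RotationSystem.glue_σ_firstCorner,
      (cyclicPred_inducedPerm M.explosionPartition i).unique (hM.cyclicPred_of_explode_σ_eq hj), hj]
  · rw [RotationSystem.glue_σ_of_not_isHead _ _ (hM.isHead_glue_explode ▸ hx),
      hM.hasHeads.explode_σ_of_not_isHead hx]

theorem glue_explode : M.explode.glue hM.isTree_explode M.explosionPartition = M :=
  congrArg₂ (fun σ hd => (⟨⟨σ, M.α, M.root, M.α_α, M.α_eq_self_iff⟩, hd⟩ : OrientedSystem n))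
    hM.glue_explode_σ hM.isHead_glue_explode

end IsTreeOriented

end OrientedSystem

namespace RotationSystem

variable {n : ℕ} {T T' : RotationSystem n} {e : Equiv.Perm (Fin (2 * n + 1))}

theorem vertex_map_iff (hσ : SemiconjBy e T.σ T'.σ) {x y : Fin (2 * n + 1)} :
    T'.vertex (e x) = T'.vertex (e y) ↔ T.vertex x = T.vertex y := by
  rw [vertex_eq_iff, vertex_eq_iff, sameCycle_map_iff hσ]

theorem corner_map (hσ : SemiconjBy e T.σ T'.σ) (hα : SemiconjBy e T.α T'.α)
    (hr : e T.root = T'.root) (j : ℕ) : e (T.corner j) = T'.corner j := by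
  have hφ : SemiconjBy e (T.facePerm ^ j) (T'.facePerm ^ j) := (hσ.mul_right hα).pow_right j
  rw [corner, corner, ← hr]
  exact (Equiv.congr_fun hα.eq _).trans (congrArg T'.α (Equiv.congr_fun hφ.eq T.root))

theorem firstCorner_map (hσ : SemiconjBy e T.σ T'.σ) (hα : SemiconjBy e T.α T'.α)
    (hr : e T.root = T'.root) (i : Fin (n + 1)) : e (T.firstCorner i) = T'.firstCorner i := by
  have hvisit : T.IsFirstVisit = T'.IsFirstVisit := by
    ext j
    simp only [IsFirstVisit, ← corner_map hσ hα hr, Ne, vertex_map_iff hσ]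
  rw [firstCorner, firstCorner, corner_map hσ hα hr, hvisit]

theorem Iso.glue (hT : T.IsTree) (hT' : T'.IsTree) (s : Setoid (Fin (n + 1))) (h : T.Iso T') :
    (T.glue hT s).Iso (T'.glue hT' s) := by
  obtain ⟨e, hσ, hα, hr⟩ := h
  have hfirst := firstCorner_map (Equiv.ext hσ) (Equiv.ext hα) hr
  have hhead (x) : (T'.glue hT' s).isHead (e x) ↔ (T.glue hT s).isHead x := by
    refine (hT'.mem_range_firstCorner_iff hT'.isArborescence).symm.trans
      (Iff.trans ?_ (hT.mem_range_firstCorner_iff hT.isArborescence))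
    simp only [Set.mem_range, ← hfirst, e.injective.eq_iff]
  refine ⟨e, fun x => ?_, hα, hr, hhead⟩
  by_cases hx : (T.glue hT s).isHead x
  · obtain ⟨i, rfl⟩ := (hT.mem_range_firstCorner_iff hT.isArborescence).2 hx
    rw [glue_σ_firstCorner, hσ, hfirst, hfirst, glue_σ_firstCorner]
  · rw [glue_σ_of_not_isHead hT s hx, glue_σ_of_not_isHead hT' s (mt (hhead x).1 hx), hσ]

end RotationSystem

namespace OrientedSystem

variable {n : ℕ} {M M' : OrientedSystem n} {e : Equiv.Perm (Fin (2 * n + 1))}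

theorem firstHead_map (hσ : SemiconjBy e M.σ M'.σ) (hd : ∀ h, M'.isHead (e h) ↔ M.isHead h)
    (x : Fin (2 * n + 1)) : e (M.firstHead x) = M'.firstHead (e x) := by
  have hpow (k : ℕ) : e ((M.σ ^ k) x) = (M'.σ ^ k) (e x) :=
    Equiv.congr_fun (hσ.pow_right k).eq x
  simp only [firstHead, hpow, ← hd]

theorem explode_σ_map (hσ : SemiconjBy e M.σ M'.σ) (hd : ∀ h, M'.isHead (e h) ↔ M.isHead h) :
    SemiconjBy e M.explode.σ M'.explode.σ :=
  Equiv.ext <| inducedFun_map hσ fun x y => by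
    simp only [Setoid.ker_def, ← firstHead_map hσ hd, e.injective.eq_iff]

theorem Iso.explode (h : M.Iso M') : M.explode.Iso M'.explode :=
  let ⟨e, hσ, hα, hr, hd⟩ := h
  ⟨e, Equiv.congr_fun (explode_σ_map (Equiv.ext hσ) hd).eq, hα, hr⟩

theorem Iso.explosionPartition_eq (h : M.Iso M') :
    M.explosionPartition = M'.explosionPartition := by
  obtain ⟨e, hσ, hα, hr, hd⟩ := h
  have hσ : SemiconjBy e M.σ M'.σ := Equiv.ext hσ
  have hfirst (i) : e (M.explode.firstCorner i) = M'.explode.firstCorner i :=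
    RotationSystem.firstCorner_map (explode_σ_map hσ hd) (Equiv.ext hα) hr i
  ext i j
  rw [explosionPartition_iff, explosionPartition_iff, ← hfirst, ← hfirst,
    RotationSystem.vertex_map_iff hσ]

end OrientedSystem

/-- Vertex explosion `φ = (φ₀, φ₁)` on isomorphism classes of tree-oriented maps. -/
noncomputable def explosion (n : ℕ) :
    TreeOrientedMap n → PlaneTree n × NonCrossingPartition (n + 1) :=
  Quotient.lift
    (fun M => (PlaneTree.mk M.1.explode M.2.isTree_explode,
      ⟨M.1.explosionPartition, M.2.isNonCrossing_explosionPartition⟩))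
    fun _ _ h => Prod.ext (Quotient.sound (s := treeSetoid n) (OrientedSystem.Iso.explode h))
      (Subtype.ext (OrientedSystem.Iso.explosionPartition_eq h))

/-- Gluing `ψ`, with the tree taken up to isomorphism. -/
noncomputable def gluing (n : ℕ) (p : PlaneTree n × NonCrossingPartition (n + 1)) :
    TreeOrientedMap n :=
  Quotient.lift (s := treeSetoid n)
    (fun T : {T : RotationSystem n // T.IsTree} => TreeOrientedMap.mk (T.1.glue T.2 p.2.1)
      (RotationSystem.isTreeOriented_glue T.2 p.2.2))
    (fun T T' h => Quotient.sound (s := treeOrientedSetoid n)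
      (RotationSystem.Iso.glue T.2 T'.2 p.2.1 h)) p.1

theorem gluing_explosion (n : ℕ) (M : TreeOrientedMap n) : gluing n (explosion n M) = M := by
  obtain ⟨⟨M, hM⟩, rfl⟩ := Quotient.exists_rep M
  exact congrArg (Quotient.mk (treeOrientedSetoid n)) (Subtype.ext hM.glue_explode)

theorem explosion_gluing (n : ℕ) (p : PlaneTree n × NonCrossingPartition (n + 1)) :
    explosion n (gluing n p) = p := by
  obtain ⟨T, s, hs⟩ := p
  obtain ⟨⟨T, hT⟩, rfl⟩ := Quotient.exists_rep T
  exact Prod.ext (congrArg (Quotient.mk (treeSetoid n))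
    (Subtype.ext (RotationSystem.explode_glue hT s)))
    (Subtype.ext (RotationSystem.explosionPartition_glue hT s))

theorem mainTheorem3 (n : ℕ) :
    ∃ (hφ₀ : ∀ M : OrientedSystem n, M.IsTreeOriented → M.explode.IsTree)
      (hφ₁ : ∀ M : OrientedSystem n, M.IsTreeOriented → IsNonCrossing M.explosionPartition)
      (hψ : ∀ (T : RotationSystem n) (hT : T.IsTree) (s : Setoid (Fin (n + 1))),
        IsNonCrossing s → (T.glue hT s).IsTreeOriented)
      (φ : TreeOrientedMap n ≃ PlaneTree n × NonCrossingPartition (n + 1)),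
      (∀ (M : OrientedSystem n) (hM : M.IsTreeOriented),
        φ (TreeOrientedMap.mk M hM) =
          (PlaneTree.mk M.explode (hφ₀ M hM), ⟨M.explosionPartition, hφ₁ M hM⟩)) ∧
      (∀ (T : RotationSystem n) (hT : T.IsTree) (s : Setoid (Fin (n + 1)))
        (hs : IsNonCrossing s),
        φ.symm (PlaneTree.mk T hT, ⟨s, hs⟩) =
          TreeOrientedMap.mk (T.glue hT s) (hψ T hT s hs)) :=
  ⟨fun _ hM => hM.isTree_explode,
    fun _ hM => hM.isNonCrossing_explosionPartition,
    fun _ hT _ hs => RotationSystem.isTreeOriented_glue hT hs,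
    ⟨explosion n, gluing n, gluing_explosion n, explosion_gluing n⟩,
    fun _ _ => rfl, fun _ _ _ _ => rfl⟩
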